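/- Let $\tau>0$ and put $\mathsf b=\sqrt\tau$. For $z\in\mathbb C$ with $|\mathrm{Im}\,z|<\pi$ consider the formal power series in $\tau$ $$\hat\phi_\tau(z)=\sum_{n=1}^\infty (2\pi i)^{2n-1}\,\frac{B_{2n}(1/2)}{(2n)!}\,\partial_z^{2n}\mathrm{Li}_2(-e^z)\,\tau^{2n-1},$$ where $B_n(x)$ are the Bernoulli polynomials and $\mathrm{Li}_2$ is the principal branch on $\mathbb C\setminus[1,\infty)$ of the dilogarithm $\sum_{k\ge1}w^k/k^2$. Then its Borel transform (defined by $\tau^{n+1}\mapsto \xi^n/n!$) converges near $\xi=0$ and continues analytically along $[0,\infty)$ to a function $G(\xi,z)$, the integral $(\mathcal LG)(\tau,z)=\int_0^\infty e^{-\xi/\tau}G(\xi,z)\,d\xi$ (the Borel sum of $\hat\phi_\tau(z)$) converges absolutely, and the function $$f_\tau(z)=\exp\Big(\frac{1}{2\pi i\tau}\mathrm{Li}_2(-e^z)+(\mathcal LG)(\tau,z)\Big),\qquad |\mathrm{Im}\,z|<\pi,$$ extends uniquely to a meromorphic function $f_\tau$ on $\mathbb C$. This function satisfies the two functional equations $$f_\tau(z-i\pi\tau)=(1+e^{z})\,f_\tau(z+i\pi\tau),\qquad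 f_\tau(z-i\pi)=(1+e^{z/\tau})\,f_\tau(z+i\pi)$$ for all $z\in\mathbb C$ for which the two points at which $f_\tau$ is evaluated are not poles of $f_\tau$. Moreover $f_\tau(z)=\Phi_{\mathsf b}\big(z/(2\pi\mathsf b)\big)$ for $|\mathrm{Im}\,z|<\pi(1+\tau)$, where $\Phi_{\mathsf b}$ is Faddeev's quantum dilogarithm $$\Phi_{\mathsf b}(w)=\exp\Big(\int_{\mathbb R+i\epsilon}\frac{e^{-2ixw}}{4\sinh(x\mathsf b)\sinh(x\mathsf b^{-1})}\frac{dx}{x}\Big),\qquad 0<\epsilon<\pi\min(\mathsf b,\mathsf b^{-1}),$$ the integral being absolutely convergent for these $z$. -/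

import Mathlib

open Complex Filter Topology MeasureTheory

noncomputable section

namespace BorelDilog

/-- The principal branch of Euler's dilogarithm on `ℂ ∖ [1, ∞)`, the analytic continuation of
`∑_{k ≥ 1} w ^ k / k ^ 2`, given by `Li₂(w) = -∫₀¹ log(1 - t w) / t dt`. -/
def dilog (w : ℂ) : ℂ :=
  -∫ t in (0 : ℝ)..1, Complex.log (1 - t * w) / t

/-- The formal power series
`φ̂_τ(z) = ∑_{n ≥ 1} (2πi)^(2n-1) B_{2n}(1/2) / (2n)! ∂_z^{2n} Li₂(-e^z) τ^(2n-1)` in `τ`: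
the exponent of `τ` is `k = 2n - 1`. -/
def phiHat (z : ℂ) : PowerSeries ℂ :=
  PowerSeries.mk fun k =>
    if Odd k then
      (2 * Real.pi * I) ^ k
        * (((Polynomial.bernoulli (k + 1)).eval (1 / 2 : ℚ) : ℚ) : ℂ) / ((k + 1).factorial : ℂ)
        * iteratedDeriv (k + 1) (fun w : ℂ => dilog (-Complex.exp w)) z
    else 0

/-- The formal Borel transform `τ^(n+1) ↦ ξ^n / n!` (meaningful on series without constant
term). -/
def borelTransform (φ : PowerSeries ℂ) : PowerSeries ℂ :=
  PowerSeries.mk fun n => PowerSeries.coeff (n + 1) φ / (n.factorial : ℂ)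

/-- `s` is the Borel sum at `τ > 0` of the formal power series `φ` without constant term: the Borel
transform of `φ` converges near `0`, it continues analytically to a function `G` on a neighbourhood
of the half-line `[0, ∞)`, and `s` is the (convergent) Laplace integral
`∫₀^∞ e^(-ξ/τ) G(ξ) dξ`. -/
def IsBorelSum (φ : PowerSeries ℂ) (τ : ℝ) (s : ℂ) : Prop :=
  PowerSeries.constantCoeff φ = 0 ∧
  ∃ G : ℂ → ℂ,
    (∀ᶠ ξ in 𝓝 (0 : ℂ),
      HasSum (fun n : ℕ => PowerSeries.coeff n (borelTransform φ) * ξ ^ n) (G ξ)) ∧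
    (∀ ξ : ℝ, 0 ≤ ξ → AnalyticAt ℂ G (ξ : ℂ)) ∧
    IntegrableOn (fun ξ : ℝ => Complex.exp (-(ξ / τ : ℝ)) * G ξ) (Set.Ioi 0) ∧
    s = ∫ ξ in Set.Ioi (0 : ℝ), Complex.exp (-(ξ / τ : ℝ)) * G ξ

/-- A formal power series has at most one Borel sum at `τ`. -/
theorem IsBorelSum.unique {φ : PowerSeries ℂ} {τ : ℝ} {s t : ℂ}
    (hs : IsBorelSum φ τ s) (ht : IsBorelSum φ τ t) : s = t := by
  obtain ⟨_, G, hG, hGa, _, rfl⟩ := hs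
  obtain ⟨_, H, hH, hHa, _, rfl⟩ := ht
  have hpre : IsPreconnected ((fun x : ℝ => (x : ℂ)) '' Set.Ici 0) :=
    isPreconnected_Ici.image _ Complex.continuous_ofReal.continuousOn
  have hEq : Set.EqOn G H ((fun x : ℝ => (x : ℂ)) '' Set.Ici 0) := by
    refine AnalyticOnNhd.eqOn_of_preconnected_of_eventuallyEq (𝕜 := ℂ) (z₀ := 0) ?_ ?_ hpre ?_ ?_
    · rintro _ ⟨x, hx, rfl⟩
      exact hGa x hx
    · rintro _ ⟨x, hx, rfl⟩
      exact hHa x hx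
    · exact ⟨0, by simp, by simp⟩
    · filter_upwards [hG, hH] with ξ h1 h2
      exact h1.unique h2
  refine setIntegral_congr_fun measurableSet_Ioi fun x hx => ?_
  have hx' : (0 : ℝ) ≤ x := le_of_lt hx
  simp only [hEq ⟨x, hx', rfl⟩]

/-- `f` is the function `f_τ` on `ℂ` obtained from the Borel summation of `φ̂_τ`: on the strip
`|Im z| < π` its logarithm is `Li₂(-e^z) / (2πiτ)` plus the Borel sum of `φ̂_τ(z)`, and `f` is the
meromorphic continuation of this to `ℂ`, normalized to be holomorphic where it has no pole (and `0`
at its poles). -/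
def IsBorelSolution (τ : ℝ) (f : ℂ → ℂ) : Prop :=
  MeromorphicNFOn f Set.univ ∧
  ∀ z : ℂ, |z.im| < Real.pi →
    ∃ s : ℂ, IsBorelSum (phiHat z) τ s ∧
      f z = Complex.exp (dilog (-Complex.exp z) / (2 * Real.pi * I * τ) + s)

/-- The integrand `e^(-2ixz) / (4 sinh(x b) sinh(x / b) x)` of Faddeev's integral. -/
def faddeevIntegrand (b : ℝ) (z x : ℂ) : ℂ :=
  Complex.exp (-2 * I * x * z) / (4 * Complex.sinh (x * b) * Complex.sinh (x / b) * x)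

/-- Faddeev's quantum dilogarithm `Φ_b(z)`, as the exponential of the integral of
`faddeevIntegrand b z` along the line `ℝ + iε`. -/
def faddeev (ε b : ℝ) (z : ℂ) : ℂ :=
  Complex.exp (∫ x : ℝ, faddeevIntegrand b z (x + I * ε))

end BorelDilog

end

/-! Write `L` for `logistic`. Everything follows from one Fourier transform: over the line `u ∈ ℝ +
iε` with `0 < ε < 1`, the integral of `e^(-iuz) / sinh(πu)` is `-2i L(z)`. This is Mellin inversion
for `1 / (1 + t)` at `t = e^(-z)` for real `z`, continued to `|Im z| < π` (`lineIntegral_inv_sinh`).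
A factor `e^(iuc)` translates `z` to `z - c`, so any superposition of such exponentials multiplying
`1 / sinh(πu)` integrates to the same superposition of translates of `L`
(`lineIntegral_superposition`).

After rescaling, the logarithm of Faddeev's function is the line integral of `e^(-iuz) / (4 u
sinh(πu) sinh(πτu))`. Split `1 / sinh(πτu)` into its polar part `1 / (πτu)` and its Mittag-Leffler
series. The polar part leaves `1 / u^2`, a superposition with weight `r dr`, and produces `Li₂(-e^z)
/ (2πiτ)`. The m-th term of the series is a Laplace transform in `ξ`, at `1/τ`, of `e^(±iuξ/m)`. The
sum therefore produces `∫ e^(-ξ/τ) G(ξ) dξ` with `G(ξ) = (2πi)⁻¹ Σ (-1)^m m⁻² (L(z + ξ/m) + L(z -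
ξ/m))` (`faddeevLog_eq`). This `G` is analytic around the real line. Its Taylor coefficients at `0`
contain `Σ (-1)^m / m^(2j)`, that is `B_{2j}(1/2)`, and derivatives of `L = -∂² Li₂(-e^z)`, so it
continues the Borel transform (`hasSum_borelTransform`).

Shifting `z` by `∓iπτ` or `∓iπ` and subtracting cancels one `sinh` in the kernel. What remains
integrates to `log(1 + e^z)` or `log(1 + e^(z/τ))`, which gives both functional equations near `0`.
The second one continues the function strip by strip to `ℂ`; the identity theorem gives uniqueness
and propagates both equations. -/

noncomputable section

namespace BorelDilog

/-! ### The logistic function in the strip `|Im w| < π` -/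

/-- The logistic function `e^w / (1 + e^w)`. -/
def logistic (w : ℂ) : ℂ := exp w / (1 + exp w)

lemma cos_half_im_pos {w : ℂ} (hw : |w.im| < Real.pi) : 0 < Real.cos (w.im / 2) := by
  obtain ⟨h1, h2⟩ := abs_lt.1 hw
  exact Real.cos_pos_of_mem_Ioo ⟨by linarith, by linarith⟩

/-- With `ρ = t e^(Re w)` and `y = Im w`, the difference of the squares of the two sides is
`sin²(y/2) (1 - ρ)²`. This single bound controls the logarithm, the dilogarithm and the logistic
function. -/
lemma cos_half_le_norm_one_add (w : ℂ) (t : ℝ) :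
    Real.cos (w.im / 2) * (1 + t * Real.exp w.re) ≤ ‖1 + t * exp w‖ := by
  have hE := Real.exp_pos w.re
  rw [Complex.norm_def]
  apply Real.le_sqrt_of_sq_le
  have h1 : (1 + t * exp w).re = 1 + t * (Real.exp w.re * Real.cos w.im) := by
    simp [Complex.exp_re]
  have h2 : (1 + t * exp w).im = t * (Real.exp w.re * Real.sin w.im) := by
    simp [Complex.exp_im]
  have hc : Real.cos w.im = 2 * Real.cos (w.im / 2) ^ 2 - 1 := by
    rw [← Real.cos_two_mul]; ring_nf
  rw [Complex.normSq_apply, h1, h2]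
  have hs : Real.sin w.im ^ 2 = 1 - Real.cos w.im ^ 2 := by rw [Real.sin_sq]
  have hk : Real.cos (w.im / 2) ^ 2 ≤ 1 := Real.cos_sq_le_one _
  have : (1 + t * (Real.exp w.re * Real.cos w.im)) * (1 + t * (Real.exp w.re * Real.cos w.im)) +
      t * (Real.exp w.re * Real.sin w.im) * (t * (Real.exp w.re * Real.sin w.im))
      = 1 + 2 * (t * Real.exp w.re) * Real.cos w.im + (t * Real.exp w.re) ^ 2 := by
    linear_combination (t * Real.exp w.re) ^ 2 * hs
  rw [this, hc]
  nlinarith [mul_nonneg (sub_nonneg.2 hk) (sq_nonneg (1 - t * Real.exp w.re))]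

lemma one_add_mul_exp_mem_slitPlane {w : ℂ} (hw : |w.im| < Real.pi) {t : ℝ} (ht : 0 ≤ t) :
    1 + t * exp w ∈ slitPlane := by
  obtain ⟨h1, h2⟩ := abs_lt.1 hw
  rw [mem_slitPlane_iff]
  rcases eq_or_lt_of_le ht with rfl | ht
  · simp
  by_cases h : Real.sin w.im = 0
  · left
    have h0 : w.im = 0 := (Real.sin_eq_zero_iff_of_lt_of_lt h1 h2).1 h
    simp only [add_re, one_re, mul_re, ofReal_re, Complex.exp_re, h0, Real.cos_zero, ofReal_im,
      zero_mul, sub_zero, mul_one]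
    positivity
  · right
    simp [Complex.exp_im, h, ht.ne']

lemma one_add_exp_mem_slitPlane {w : ℂ} (hw : |w.im| < Real.pi) : 1 + exp w ∈ slitPlane := by
  simpa using one_add_mul_exp_mem_slitPlane hw zero_le_one

lemma one_add_exp_ne_zero {w : ℂ} (hw : |w.im| < Real.pi) : 1 + exp w ≠ 0 :=
  slitPlane_ne_zero (one_add_exp_mem_slitPlane hw)

lemma norm_logistic_le_exp {w : ℂ} (hw : |w.im| < Real.pi) :
    ‖logistic w‖ ≤ Real.exp w.re / Real.cos (w.im / 2) := by
  have hc := cos_half_im_pos hw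
  have h := cos_half_le_norm_one_add w 1
  have hE := Real.exp_pos w.re
  rw [logistic, norm_div, norm_exp]
  simp only [ofReal_one, one_mul] at h
  gcongr
  nlinarith

lemma norm_logistic_le {w : ℂ} (hw : |w.im| < Real.pi) :
    ‖logistic w‖ ≤ 1 / Real.cos (w.im / 2) := by
  have hc := cos_half_im_pos hw
  have h := cos_half_le_norm_one_add w 1
  have hE := Real.exp_pos w.re
  rw [logistic, norm_div, norm_exp]
  simp only [ofReal_one, one_mul] at h
  rw [div_le_div_iff₀ (by nlinarith) hc]
  nlinarith

lemma isOpen_strip (a : ℝ) : IsOpen {z : ℂ | |z.im| < a} :=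
  isOpen_lt (by fun_prop) continuous_const

lemma strip_mem_nhds {a : ℝ} {z : ℂ} (hz : |z.im| < a) : {z : ℂ | |z.im| < a} ∈ 𝓝 z :=
  (isOpen_strip a).mem_nhds hz

lemma convex_strip (a : ℝ) : Convex ℝ {z : ℂ | |z.im| < a} := by
  have : {z : ℂ | |z.im| < a} = Complex.imLm ⁻¹' Set.Ioo (-a) a := by
    ext z; simp [abs_lt]
  rw [this]
  exact (convex_Ioo _ _).linear_preimage _

lemma analyticAt_logistic {w : ℂ} (hw : |w.im| < Real.pi) : AnalyticAt ℂ logistic w :=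
  AnalyticAt.div (by fun_prop) (by fun_prop) (one_add_exp_ne_zero hw)

/-- Mean value inequality in the real parameter on `[0, t]`. The factor `t` compensates the `1/t` in
the integrand of `dilog`. -/
lemma norm_log_one_add_mul_exp_le {w : ℂ} (hw : |w.im| < Real.pi) {t : ℝ} (ht : 0 ≤ t) :
    ‖log (1 + t * exp w)‖ ≤ Real.exp w.re / Real.cos (w.im / 2) * t := by
  have hc := cos_half_im_pos hw
  have hE := Real.exp_pos w.re
  have hd : ∀ s ∈ Set.Icc 0 t, HasDerivWithinAt (fun s : ℝ => log (1 + s * exp w))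
      (exp w / (1 + s * exp w)) (Set.Icc 0 t) s := by
    intro s hs
    have h1 : HasDerivAt (fun s : ℝ => 1 + (s : ℂ) * exp w) (exp w) s := by
      simpa using ((HasDerivAt.ofReal_comp (hasDerivAt_id s)).mul_const (exp w)).const_add 1
    exact (h1.clog_real (one_add_mul_exp_mem_slitPlane hw hs.1)).hasDerivWithinAt
  have := Convex.norm_image_sub_le_of_norm_hasDerivWithin_le (C := Real.exp w.re / Real.cos (w.im / 2))
    hd (fun s hs => ?_) (convex_Icc 0 t) (Set.left_mem_Icc.2 ht) (Set.right_mem_Icc.2 ht)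
  · simpa [abs_of_nonneg ht] using this
  · have h := cos_half_le_norm_one_add w s
    rw [norm_div, norm_exp]
    gcongr
    nlinarith [mul_nonneg hc.le (mul_nonneg hs.1 hE.le)]

lemma norm_log_one_add_exp_le {w : ℂ} (hw : |w.im| < Real.pi) :
    ‖log (1 + exp w)‖ ≤ Real.exp w.re / Real.cos (w.im / 2) := by
  simpa using norm_log_one_add_mul_exp_le hw zero_le_one

lemma norm_dilog_neg_exp_le {w : ℂ} (hw : |w.im| < Real.pi) :
    ‖dilog (-exp w)‖ ≤ Real.exp w.re / Real.cos (w.im / 2) := by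
  rw [dilog, norm_neg]
  refine (intervalIntegral.norm_integral_le_of_norm_le_const
    (C := Real.exp w.re / Real.cos (w.im / 2)) fun t ht => ?_).trans (by simp)
  rw [Set.uIoc_of_le zero_le_one] at ht
  have := norm_log_one_add_mul_exp_le hw ht.1.le
  rw [norm_div, norm_real, Real.norm_of_nonneg ht.1.le, div_le_iff₀ ht.1, mul_neg, sub_neg_eq_add]
  exact this

/-! ### Logarithm and dilogarithm as integrals of translates of the logistic function -/

lemma hasDerivAt_log_one_add_exp {z : ℂ} (hz : |z.im| < Real.pi) :
    HasDerivAt (fun w => log (1 + exp w)) (logistic z) z :=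
  ((hasDerivAt_exp z).const_add 1).clog (one_add_exp_mem_slitPlane hz)

lemma integral_exp_div_one_add {z : ℂ} (hz : |z.im| < Real.pi) :
    ∫ t in (0 : ℝ)..1, exp z / (1 + t * exp z) = log (1 + exp z) := by
  have h1 : ∀ s : ℝ, HasDerivAt (fun s : ℝ => 1 + (s : ℂ) * exp z) (exp z) s := fun s => by
    simpa using ((HasDerivAt.ofReal_comp (hasDerivAt_id s)).mul_const (exp z)).const_add 1
  rw [intervalIntegral.integral_eq_sub_of_hasDerivAt
    (f := fun s : ℝ => log (1 + s * exp z))]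
  · simp
  · intro s hs
    rw [Set.uIcc_of_le zero_le_one] at hs
    exact (h1 s).clog_real (one_add_mul_exp_mem_slitPlane hz hs.1)
  · apply ContinuousOn.intervalIntegrable
    intro s hs
    rw [Set.uIcc_of_le zero_le_one] at hs
    exact (continuousAt_const.div (h1 s).continuousAt
      (slitPlane_ne_zero (one_add_mul_exp_mem_slitPlane hz hs.1))).continuousWithinAt

lemma hasDerivAt_dilog_neg_exp {z : ℂ} (hz : |z.im| < Real.pi) :
    HasDerivAt (fun w => dilog (-exp w)) (-log (1 + exp z)) z := by
  -- A strip of half-width `Y` strictly between `|Im z|` and `π` keeps `cos(Im w / 2)` bounded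
  -- below; together with a bound on `Re w` it dominates the derivative uniformly.
  set Y : ℝ := (|z.im| + Real.pi) / 2 with hY
  have hYπ : Y < Real.pi := by linarith
  have hzY : |z.im| < Y := by linarith
  have hY0 : 0 < Y := (abs_nonneg _).trans_lt hzY
  have hcY : 0 < Real.cos (Y / 2) := Real.cos_pos_of_mem_Ioo ⟨by linarith, by linarith⟩
  have hs : {w : ℂ | |w.im| < Y} ∩ {w : ℂ | w.re < z.re + 1} ∈ 𝓝 z := by
    refine inter_mem (strip_mem_nhds hzY) ?_
    exact (isOpen_lt (by fun_prop) continuous_const).mem_nhds (by simp)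
  have hmeas : ∀ w : ℂ, Measurable fun t : ℝ => log (1 - t * -exp w) / t := fun w => by
    fun_prop
  have key := intervalIntegral.hasDerivAt_integral_of_dominated_loc_of_deriv_le
    (μ := volume) (a := (0 : ℝ)) (b := 1) (𝕜 := ℂ) (x₀ := z) (s := _)
    (F := fun w t => log (1 - t * -exp w) / t)
    (F' := fun w t => exp w / (1 + t * exp w))
    (bound := fun _ => Real.exp (z.re + 1) / Real.cos (Y / 2)) hs
    (.of_forall fun w => (hmeas w).aestronglyMeasurable) ?_ ?_ ?_ ?_ ?_
  · rw [integral_exp_div_one_add hz] at key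
    exact key.2.neg
  · rw [intervalIntegrable_iff, Set.uIoc_of_le zero_le_one]
    refine Measure.integrableOn_of_bounded (M := Real.exp z.re / Real.cos (z.im / 2)) (by simp)
      (hmeas z).aestronglyMeasurable ?_
    filter_upwards [ae_restrict_mem measurableSet_Ioc] with t ht
    have := norm_log_one_add_mul_exp_le hz ht.1.le
    rw [norm_div, norm_real, Real.norm_of_nonneg ht.1.le, div_le_iff₀ ht.1, mul_neg,
      sub_neg_eq_add]
    exact this
  · apply Measurable.aestronglyMeasurable
    fun_prop
  · refine .of_forall fun t ht w hw => ?_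
    rw [Set.uIoc_of_le zero_le_one] at ht
    have hw1 : |w.im| < Y := hw.1
    have hw2 : w.re < z.re + 1 := hw.2
    have hcos : Real.cos (Y / 2) ≤ Real.cos (w.im / 2) := by
      rw [← Real.cos_abs (w.im / 2)]
      apply Real.cos_le_cos_of_nonneg_of_le_pi (abs_nonneg _) (by linarith)
      rw [abs_div, abs_two]; linarith
    have h := cos_half_le_norm_one_add w t
    have := mul_nonneg (hcY.le.trans hcos) (mul_nonneg ht.1.le (Real.exp_pos w.re).le)
    rw [norm_div, norm_exp]
    gcongr
    nlinarith
  · exact intervalIntegrable_const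
  · refine .of_forall fun t ht w hw => ?_
    rw [Set.uIoc_of_le zero_le_one] at ht
    have hw1 : |w.im| < Real.pi := lt_trans hw.1 hYπ
    have hsl := one_add_mul_exp_mem_slitPlane hw1 ht.1.le
    have h1 : HasDerivAt (fun w => 1 - (t : ℂ) * -exp w) (t * exp w) w := by
      simpa using ((hasDerivAt_exp w).const_mul (t : ℂ)).const_add 1
    have h2 := (h1.clog (by simpa using hsl)).div_const (t : ℂ)
    have ht0 : (t : ℂ) ≠ 0 := by exact_mod_cast ht.1.ne'
    convert! h2 using 1
    have := slitPlane_ne_zero hsl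
    rw [mul_neg, sub_neg_eq_add]
    field_simp

lemma tendsto_exp_sub_mul (x c : ℝ) (p : ℕ) :
    Tendsto (fun r : ℝ => r ^ p * (Real.exp (x - r) / c)) atTop (𝓝 0) := by
  have := (Real.tendsto_pow_mul_exp_neg_atTop_nhds_zero p).mul_const (Real.exp x / c)
  rw [zero_mul] at this
  refine this.congr fun r => ?_
  rw [sub_eq_add_neg, Real.exp_add]; ring

lemma integrableOn_exp_sub_mul (x c : ℝ) (p : ℕ) :
    IntegrableOn (fun r : ℝ => r ^ p * (Real.exp (x - r) / c)) (Set.Ioi 0) := by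
  have h := (Real.GammaIntegral_convergent (s := p + 1) (by positivity)).mul_const
    (Real.exp x / c)
  refine IntegrableOn.congr_fun h (fun r hr => ?_) measurableSet_Ioi
  simp only [add_sub_cancel_right, Real.rpow_natCast]
  rw [sub_eq_add_neg, Real.exp_add]; ring

lemma integrableOn_pow_mul_logistic_sub {z : ℂ} (hz : |z.im| < Real.pi) (p : ℕ) :
    IntegrableOn (fun r : ℝ => (r : ℂ) ^ p * logistic (z - r)) (Set.Ioi 0) := by
  refine Integrable.mono' (integrableOn_exp_sub_mul z.re (Real.cos (z.im / 2)) p) ?_ ?_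
  · apply Measurable.aestronglyMeasurable
    unfold logistic
    fun_prop
  · filter_upwards [ae_restrict_mem measurableSet_Ioi] with r hr
    have := norm_logistic_le_exp (w := z - r) (by simpa using hz)
    simp only [sub_re, ofReal_re, sub_im, ofReal_im, sub_zero] at this
    rw [norm_mul, norm_pow, norm_real, Real.norm_of_nonneg (le_of_lt hr)]
    exact mul_le_mul_of_nonneg_left this (pow_nonneg (le_of_lt hr) _)

lemma integral_logistic_sub {z : ℂ} (hz : |z.im| < Real.pi) :
    ∫ r in Set.Ioi (0 : ℝ), logistic (z - r) = log (1 + exp z) := by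
  have him : ∀ r : ℝ, |(z - r).im| < Real.pi := fun r => by simpa using hz
  have hlog : ∀ r : ℝ, HasDerivAt (fun r : ℝ => -log (1 + exp (z - r))) (logistic (z - r)) r := by
    intro r
    have h1 : HasDerivAt (fun r : ℝ => z - (r : ℂ)) (-1) r := by
      simpa using (HasDerivAt.ofReal_comp (hasDerivAt_id r)).const_sub z
    convert! ((hasDerivAt_log_one_add_exp (him r)).comp r h1).neg using 1
    simp
  rw [integral_Ioi_of_hasDerivAt_of_tendsto' (fun r _ => hlog r)
    (by simpa using integrableOn_pow_mul_logistic_sub hz 0) (m := 0)]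
  · simp
  · refine squeeze_zero_norm (fun r => ?_)
      (by simpa using tendsto_exp_sub_mul z.re (Real.cos (z.im / 2)) 0)
    simpa using norm_log_one_add_exp_le (him r)

lemma integral_mul_logistic_sub {z : ℂ} (hz : |z.im| < Real.pi) :
    ∫ r in Set.Ioi (0 : ℝ), r * logistic (z - r) = -dilog (-exp z) := by
  have him : ∀ r : ℝ, |(z - r).im| < Real.pi := fun r => by simpa using hz
  -- Primitive from integration by parts; both of its terms decay like `e^(-r)` up to a factor `r`.
  have hd : ∀ r : ℝ, HasDerivAt
      (fun r : ℝ => -(r * log (1 + exp (z - r))) + dilog (-exp (z - r)))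
      (r * logistic (z - r)) r := by
    intro r
    have h0 : HasDerivAt (fun r : ℝ => (r : ℂ)) 1 r := by
      simpa using (HasDerivAt.ofReal_comp (hasDerivAt_id r))
    have h1 : HasDerivAt (fun r : ℝ => z - (r : ℂ)) (-1) r := by
      simpa using h0.const_sub z
    have h2 := ((hasDerivAt_log_one_add_exp (him r)).comp r h1)
    have h3 := ((hasDerivAt_dilog_neg_exp (him r)).comp r h1)
    convert! (h0.mul h2).neg.add h3 using 1
    simp
  rw [integral_Ioi_of_hasDerivAt_of_tendsto' (fun r _ => hd r)
    (by simpa using integrableOn_pow_mul_logistic_sub hz 1) (m := 0)]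
  · simp
  · rw [← add_zero (0 : ℂ)]
    apply Tendsto.add
    · refine squeeze_zero_norm' ?_ (tendsto_exp_sub_mul z.re (Real.cos (z.im / 2)) 1)
      filter_upwards [eventually_ge_atTop 0] with r hr
      have := norm_log_one_add_exp_le (him r)
      simp only [sub_re, ofReal_re, sub_im, ofReal_im, sub_zero] at this
      rw [norm_neg, norm_mul, norm_real, Real.norm_of_nonneg hr, pow_one]
      exact mul_le_mul_of_nonneg_left this hr
    · refine squeeze_zero_norm (fun r => ?_)
        (by simpa using tendsto_exp_sub_mul z.re (Real.cos (z.im / 2)) 0)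
      simpa using norm_dilog_neg_exp_le (him r)

/-! ### The Mellin transform of `1 / (1 + t)` -/

lemma image_div_one_sub : (fun x : ℝ => x / (1 - x)) '' Set.Ioo 0 1 = Set.Ioi 0 := by
  ext y
  simp only [Set.mem_image, Set.mem_Ioo, Set.mem_Ioi]
  constructor
  · rintro ⟨x, ⟨h0, h1⟩, rfl⟩
    exact div_pos h0 (by linarith)
  · intro hy
    refine ⟨y / (1 + y), ⟨by positivity, by rw [div_lt_one (by positivity)]; linarith⟩, ?_⟩
    field_simp
    ring

lemma injOn_div_one_sub : Set.InjOn (fun x : ℝ => x / (1 - x)) (Set.Ioo 0 1) := by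
  intro x hx y hy h
  have h1 : (1 - x) ≠ 0 := by linarith [hx.2]
  have h2 : (1 - y) ≠ 0 := by linarith [hy.2]
  simp only at h
  rw [div_eq_div_iff h1 h2] at h
  linarith

lemma hasDerivWithinAt_div_one_sub (x : ℝ) (hx : x ∈ Set.Ioo (0 : ℝ) 1) :
    HasDerivWithinAt (fun x : ℝ => x / (1 - x)) (1 / (1 - x) ^ 2) (Set.Ioo 0 1) x := by
  have h1 : (1 - x) ≠ 0 := by linarith [hx.2]
  convert! ((hasDerivAt_id x).div ((hasDerivAt_id x).const_sub 1) h1).hasDerivWithinAt using 1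
  simp

lemma beta_integrand_eq (s : ℂ) {x : ℝ} (hx : x ∈ Set.Ioo (0 : ℝ) 1) :
    |1 / (1 - x) ^ 2| • (((x / (1 - x) : ℝ) : ℂ) ^ (s - 1) • (1 / (1 + ((x / (1 - x) : ℝ) : ℂ)))) =
      (x : ℂ) ^ (s - 1) * (1 - (x : ℂ)) ^ ((1 - s) - 1) := by
  have h1 : (0 : ℝ) < 1 - x := by linarith [hx.2]
  have h1' : (1 - (x : ℂ)) ≠ 0 := by exact_mod_cast h1.ne'
  have e1 : (1 - (x : ℂ)) = ((1 - x : ℝ) : ℂ) := by push_cast; rfl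
  rw [abs_of_pos (by positivity), div_eq_mul_inv x, ofReal_mul,
    mul_cpow_ofReal_nonneg hx.1.le (by positivity), ofReal_inv,
    inv_cpow _ _ (by rw [arg_ofReal_of_nonneg h1.le]; exact Real.pi_pos.ne), ← e1,
    show (1 - s) - 1 = -(s - 1) - 1 by ring, cpow_sub (-(s - 1)) 1 h1', cpow_neg, cpow_one,
    Complex.real_smul, smul_eq_mul]
  have : (1 + (x : ℂ) * (1 - (x : ℂ))⁻¹) = (1 - (x : ℂ))⁻¹ := by field_simp; ring
  rw [this]
  push_cast
  field_simp

lemma integrableOn_Ioi_cpow_div_one_add {s : ℂ} (h0 : 0 < s.re) (h1 : s.re < 1) :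
    MellinConvergent (fun t : ℝ => 1 / (1 + (t : ℂ))) s := by
  have := betaIntegral_convergent (u := s) (v := 1 - s) h0 (by simpa using h1)
  rw [intervalIntegrable_iff, Set.uIoc_of_le zero_le_one] at this
  rw [MellinConvergent, ← image_div_one_sub,
    integrableOn_image_iff_integrableOn_abs_deriv_smul measurableSet_Ioo
      hasDerivWithinAt_div_one_sub injOn_div_one_sub]
  exact (this.mono_set Set.Ioo_subset_Ioc_self).congr_fun
    (fun x hx => (beta_integrand_eq s hx).symm) measurableSet_Ioo

/-- The substitution `t = x / (1 - x)` turns the transform into the Beta integral `B(s, 1 - s) =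
Γ(s) Γ(1 - s)`, and the reflection formula evaluates it. -/
lemma mellin_one_div_one_add {s : ℂ} (h0 : 0 < s.re) (h1 : s.re < 1) :
    mellin (fun t : ℝ => 1 / (1 + (t : ℂ))) s = Real.pi / sin (Real.pi * s) := by
  rw [mellin, ← image_div_one_sub, integral_image_eq_integral_abs_deriv_smul measurableSet_Ioo
    hasDerivWithinAt_div_one_sub injOn_div_one_sub,
    setIntegral_congr_fun measurableSet_Ioo fun x hx => beta_integrand_eq s hx,
    ← integral_Ioc_eq_integral_Ioo, ← intervalIntegral.integral_of_le zero_le_one]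
  have := Gamma_mul_Gamma_eq_betaIntegral (s := s) (t := 1 - s) h0 (by simpa using h1)
  rw [add_sub_cancel, Complex.Gamma_one, one_mul, Complex.Gamma_mul_Gamma_one_sub] at this
  exact this.symm

/-! ### Integrals over the line `ℝ + iε` -/

/-- The point with real part `x` of the line `ℝ + iε`. -/
abbrev linePt (ε x : ℝ) : ℂ := x + I * ε

lemma linePt_ne_zero {ε : ℝ} (hε : 0 < ε) (x : ℝ) : linePt ε x ≠ 0 := by
  intro h
  have := congrArg Complex.im h
  simp at this
  exact hε.ne' this

/-- The squared modulus is `sinh² a cos² b + cosh² a sin² b`; only the second summand is kept. -/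
lemma norm_sinh_ge (a b : ℝ) (hb : 0 ≤ Real.sin b) :
    Real.sin b / 2 * Real.exp |a| ≤ ‖sinh (a + I * b)‖ := by
  have h1 : Real.exp |a| / 2 ≤ Real.cosh a := by
    rw [← Real.cosh_abs, Real.cosh_eq]
    linarith [Real.exp_pos (-|a|)]
  have h2 : Real.sin b * Real.cosh a ≤ ‖sinh (a + I * b)‖ := by
    rw [mul_comm I, sinh_add, sinh_mul_I, cosh_mul_I, Complex.norm_def]
    apply Real.le_sqrt_of_sq_le
    rw [← ofReal_sinh, ← ofReal_cosh, ← ofReal_sin, ← ofReal_cos, ← mul_assoc, ← ofReal_mul,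
      ← ofReal_mul, normSq_add_mul_I]
    have := Real.cosh_sq a
    have := Real.sin_sq_add_cos_sq b
    nlinarith [sq_nonneg (Real.sin b), sq_nonneg (Real.sinh a), sq_nonneg (Real.cos b)]
  calc _ = Real.sin b * (Real.exp |a| / 2) := by ring
    _ ≤ _ := mul_le_mul_of_nonneg_left h1 hb
    _ ≤ _ := h2

lemma norm_sinh_linePt_ge {c ε : ℝ} (hc : 0 < c) (hε : 0 < ε) (h : c * ε < Real.pi) (x : ℝ) :
    Real.sin (c * ε) / 2 * Real.exp (c * |x|) ≤ ‖sinh (c * linePt ε x)‖ := by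
  have := norm_sinh_ge (c * x) (c * ε)
    (Real.sin_nonneg_of_nonneg_of_le_pi (by positivity) h.le)
  rw [abs_mul, abs_of_pos hc] at this
  convert this using 3
  simp only [linePt]; push_cast; ring

lemma sin_mul_pos {c ε : ℝ} (hc : 0 < c) (hε : 0 < ε) (h : c * ε < Real.pi) :
    0 < Real.sin (c * ε) := Real.sin_pos_of_pos_of_lt_pi (by positivity) h

lemma sinh_linePt_ne_zero {c ε : ℝ} (hc : 0 < c) (hε : 0 < ε) (h : c * ε < Real.pi) (x : ℝ) :
    sinh (c * linePt ε x) ≠ 0 := by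
  rw [← norm_pos_iff]
  have := sin_mul_pos hc hε h
  exact lt_of_lt_of_le (by positivity) (norm_sinh_linePt_ge hc hε h x)

lemma norm_inv_sinh_linePt_le {c ε : ℝ} (hc : 0 < c) (hε : 0 < ε) (h : c * ε < Real.pi) (x : ℝ) :
    ‖(sinh (c * linePt ε x))⁻¹‖ ≤ 2 / Real.sin (c * ε) * Real.exp (-(c * |x|)) := by
  have h1 := norm_sinh_linePt_ge hc hε h x
  have h2 := sin_mul_pos hc hε h
  rw [norm_inv, Real.exp_neg]
  refine (inv_anti₀ (by positivity) h1).trans (le_of_eq ?_)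
  field_simp

lemma integrable_exp_neg_mul_abs {a : ℝ} (ha : 0 < a) :
    Integrable fun x : ℝ => Real.exp (-(a * |x|)) := by
  rw [← integrableOn_univ, ← Set.Iic_union_Ioi (a := (0 : ℝ)), integrableOn_union]
  refine ⟨(integrableOn_exp_mul_Iic ha 0).congr_fun (fun x hx => ?_) measurableSet_Iic,
    (integrableOn_exp_mul_Ioi (neg_lt_zero.2 ha) 0).congr_fun (fun x hx => ?_) measurableSet_Ioi⟩
  · simp [abs_of_nonpos (Set.mem_Iic.1 hx)]
  · simp [abs_of_pos (Set.mem_Ioi.1 hx)]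

lemma norm_exp_linePt (ε x : ℝ) (z : ℂ) :
    ‖exp (-I * linePt ε x * z)‖ = Real.exp (x * z.im + ε * z.re) := by
  rw [norm_exp]
  simp

lemma norm_exp_linePt_le (ε x : ℝ) (z : ℂ) :
    ‖exp (-I * linePt ε x * z)‖ ≤ Real.exp (ε * z.re) * Real.exp (|z.im| * |x|) := by
  rw [norm_exp_linePt, ← Real.exp_add, add_comm, mul_comm |z.im|, ← abs_mul]
  gcongr
  exact le_abs_self _

/-- The integral `∫ e^(-iuz) h` over the line `u ∈ ℝ + iε`. -/
def lineIntegral (ε : ℝ) (h : ℝ → ℂ) (z : ℂ) : ℂ := ∫ x : ℝ, exp (-I * linePt ε x * z) * h x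

lemma integrable_lineIntegral {ε a C : ℝ} {h : ℝ → ℂ} (hm : AEStronglyMeasurable h)
    (hb : ∀ x, ‖h x‖ ≤ C * Real.exp (-(a * |x|))) {z : ℂ} (hz : |z.im| < a) :
    Integrable fun x : ℝ => exp (-I * linePt ε x * z) * h x := by
  refine Integrable.mono' ((integrable_exp_neg_mul_abs (sub_pos.2 hz)).const_mul
    (Real.exp (ε * z.re) * C)) ?_ (.of_forall fun x => ?_)
  · exact AEStronglyMeasurable.mul (Continuous.aestronglyMeasurable (by fun_prop)) hm
  · rw [norm_mul]
    refine (mul_le_mul (norm_exp_linePt_le ε x z) (hb x) (norm_nonneg _) (by positivity)).trans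
      (le_of_eq ?_)
    rw [show -((a - |z.im|) * |x|) = |z.im| * |x| + -(a * |x|) by ring, Real.exp_add]
    ring

lemma differentiableAt_lineIntegral {ε a C : ℝ} {h : ℝ → ℂ} (hm : AEStronglyMeasurable h)
    (hb : ∀ x, ‖h x‖ ≤ C * Real.exp (-(a * |x|))) {z : ℂ} (hz : |z.im| < a) :
    DifferentiableAt ℂ (lineIntegral ε h) z := by
  -- Differentiation brings down a factor of size `|x| + |ε|`. The gap `d = Y' - Y` absorbs it,
  -- through `|x| ≤ e^(d|x|) / d`, and decay at rate `a - Y'` is left over.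
  obtain ⟨Y, hzY, hYa⟩ := exists_between hz
  obtain ⟨Y', hYY', hY'a⟩ := exists_between hYa
  have hC : 0 ≤ C := by
    have := (norm_nonneg _).trans (hb 0)
    simpa using this
  set d := Y' - Y
  have hd : 0 < d := sub_pos.2 hYY'
  set M : ℝ := |ε| * (|z.re| + 1)
  have hs : {w : ℂ | |w.im| < Y} ∩ {w : ℂ | |w.re| < |z.re| + 1} ∈ 𝓝 z := by
    refine inter_mem (strip_mem_nhds hzY) ?_
    exact (isOpen_lt (by fun_prop) continuous_const).mem_nhds (by simp)
  refine (hasDerivAt_integral_of_dominated_loc_of_deriv_le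
    (F := fun w (x : ℝ) => exp (-I * linePt ε x * w) * h x)
    (F' := fun w (x : ℝ) => exp (-I * linePt ε x * w) * (-I * linePt ε x) * h x)
    (bound := fun x => Real.exp M * (1 / d + |ε|) * C * Real.exp (-((a - Y') * |x|))) hs
    (.of_forall fun w => ?_) (integrable_lineIntegral hm hb hz) ?_ (.of_forall fun x w hw => ?_)
    ((integrable_exp_neg_mul_abs (sub_pos.2 hY'a)).const_mul _)
    (.of_forall fun x w hw => ?_)).2.differentiableAt
  · exact AEStronglyMeasurable.mul (Continuous.aestronglyMeasurable (by fun_prop)) hm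
  · exact AEStronglyMeasurable.mul (Continuous.aestronglyMeasurable (by fun_prop)) hm
  · have hw1 : |w.im| < Y := hw.1
    have hw2 : |w.re| < |z.re| + 1 := hw.2
    have h1 : ‖exp (-I * linePt ε x * w)‖ ≤ Real.exp M * Real.exp (Y * |x|) := by
      refine (norm_exp_linePt_le ε x w).trans ?_
      gcongr
      calc ε * w.re ≤ |ε * w.re| := le_abs_self _
        _ = |ε| * |w.re| := abs_mul _ _
        _ ≤ M := mul_le_mul_of_nonneg_left hw2.le (abs_nonneg _)
    have h2 : ‖-I * linePt ε x‖ ≤ (1 / d + |ε|) * Real.exp (d * |x|) := by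
      have e1 : ‖-I * linePt ε x‖ ≤ |x| + |ε| := by
        rw [norm_mul, norm_neg, norm_I, one_mul]
        refine (norm_add_le _ _).trans ?_
        simp
      have e2 := Real.add_one_le_exp (d * |x|)
      have e3 : 0 ≤ d * |x| := by positivity
      have e4 : |x| ≤ 1 / d * Real.exp (d * |x|) := by
        rw [one_div, ← div_eq_inv_mul, le_div_iff₀ hd]; linarith
      have e5 : |ε| ≤ |ε| * Real.exp (d * |x|) :=
        le_mul_of_one_le_right (abs_nonneg _) (by linarith)
      linarith
    rw [norm_mul, norm_mul]
    refine (mul_le_mul (mul_le_mul h1 h2 (norm_nonneg _) (by positivity)) (hb x) (norm_nonneg _)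
      (by positivity)).trans (le_of_eq ?_)
    rw [show -((a - Y') * |x|) = Y * |x| + d * |x| + -(a * |x|) by simp only [d]; ring,
      Real.exp_add, Real.exp_add]
    ring
  · have := ((hasDerivAt_id w).const_mul (-I * linePt ε x)).cexp.mul_const (h x)
    simpa using this

/-! ### The Fourier transform of `1 / sinh` -/

lemma aestronglyMeasurable_inv_sinh (c ε : ℝ) :
    AEStronglyMeasurable fun x : ℝ => (sinh (c * linePt ε x))⁻¹ :=
  Measurable.aestronglyMeasurable (by fun_prop)

/-- Mellin inversion on the abscissa `ε`, evaluated at `t = e^(-y)`. The Mellin variable is `s =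
-iu`, which turns `π / sin(πs)` into `πi / sinh(πu)` and `t^(-s)` into `e^(-iuy)`. -/
lemma lineIntegral_inv_sinh_ofReal {ε : ℝ} (hε : 0 < ε) (h : ε < 1) (y : ℝ) :
    lineIntegral ε (fun x => (sinh (Real.pi * linePt ε x))⁻¹) y = -2 * I * logistic y := by
  have hpε : Real.pi * ε < Real.pi := by nlinarith [Real.pi_pos]
  have hmel : ∀ x : ℝ, mellin (fun t : ℝ => 1 / (1 + (t : ℂ))) (ε + x * I) =
      Real.pi * I * (sinh (Real.pi * linePt ε (-x)))⁻¹ := by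
    intro x
    rw [mellin_one_div_one_add (by simpa using hε) (by simpa using h),
      show (Real.pi * (ε + x * I) : ℂ) = -((Real.pi * linePt ε (-x)) * I) by
        simp only [linePt]; push_cast; linear_combination (Real.pi * ε : ℂ) * I_sq,
      sin_neg, sin_mul_I]
    have := sinh_linePt_ne_zero Real.pi_pos hε hpε (-x)
    have hI := I_ne_zero
    field_simp
    rw [I_sq]
  have hbd := norm_inv_sinh_linePt_le Real.pi_pos hε hpε
  have hint := integrable_lineIntegral (ε := ε) (aestronglyMeasurable_inv_sinh Real.pi ε) hbd (z := 0)
    (by simpa using Real.pi_pos)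
  have key := mellinInv_mellin_eq ε (fun t : ℝ => 1 / (1 + (t : ℂ))) (x := Real.exp (-y))
    (Real.exp_pos _) (integrableOn_Ioi_cpow_div_one_add (by simpa using hε) (by simpa using h)) ?_ ?_
  · rw [mellinInv] at key
    simp only [hmel] at key
    rw [← integral_neg_eq_self] at key
    have e : ∀ x : ℝ, ((Real.exp (-y) : ℝ) : ℂ) ^ (-(ε + (-x : ℝ) * I) : ℂ) •
        (Real.pi * I * (sinh (Real.pi * linePt ε (- -x)))⁻¹) =
        Real.pi * I * (exp (-I * linePt ε x * y) * (sinh (Real.pi * linePt ε x))⁻¹) := by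
      intro x
      rw [cpow_def_of_ne_zero (by exact_mod_cast (Real.exp_pos _).ne'), ← ofReal_log
        (Real.exp_pos _).le, Real.log_exp, neg_neg, smul_eq_mul,
        show ((-y : ℝ) : ℂ) * -(ε + (-x : ℝ) * I) = -I * linePt ε x * y by
          simp only [linePt]; push_cast; linear_combination (ε * y : ℂ) * I_sq]
      ring
    simp only [e] at key
    rw [integral_const_mul, Complex.real_smul] at key
    rw [lineIntegral]
    have hl : (logistic y) = 1 / (1 + ((Real.exp (-y) : ℝ) : ℂ)) := by
      rw [logistic]
      push_cast
      rw [exp_neg]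
      have h1 := exp_ne_zero (y : ℂ)
      have h2 := one_add_exp_ne_zero (w := (y : ℂ)) (by simpa using Real.pi_pos)
      have h3 : 1 + (exp (y : ℂ))⁻¹ ≠ 0 := by
        rw [show 1 + (exp (y : ℂ))⁻¹ = (1 + exp y) * (exp y)⁻¹ by field_simp; ring]
        exact mul_ne_zero h2 (inv_ne_zero h1)
      rw [div_eq_div_iff h2 h3]
      field_simp
      ring
    rw [hl, ← key]
    have hπ : (Real.pi : ℂ) ≠ 0 := by exact_mod_cast Real.pi_pos.ne'
    generalize (∫ x : ℝ, exp (-I * linePt ε x * y) * (sinh (Real.pi * linePt ε x))⁻¹) = J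
    push_cast
    field_simp
    linear_combination J * I_sq
  · rw [VerticalIntegrable]
    simp only [hmel]
    apply Integrable.const_mul
    have := hint.comp_neg
    simpa using this
  · refine ContinuousAt.div (by fun_prop) (by fun_prop) ?_
    exact_mod_cast (by positivity : (0 : ℝ) < 1 + Real.exp (-y)).ne'

/-- Both sides are analytic in the strip and agree on the real axis. -/
lemma lineIntegral_inv_sinh {ε : ℝ} (hε : 0 < ε) (h : ε < 1) {z : ℂ} (hz : |z.im| < Real.pi) :
    lineIntegral ε (fun x => (sinh (Real.pi * linePt ε x))⁻¹) z = -2 * I * logistic z := by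
  have hpε : Real.pi * ε < Real.pi := by nlinarith [Real.pi_pos]
  have hbd := norm_inv_sinh_linePt_le Real.pi_pos hε hpε
  have hU := isOpen_strip Real.pi
  have h1 : AnalyticOnNhd ℂ (lineIntegral ε (fun x => (sinh (Real.pi * linePt ε x))⁻¹))
      {z : ℂ | |z.im| < Real.pi} :=
    DifferentiableOn.analyticOnNhd (fun w hw => (differentiableAt_lineIntegral
      (aestronglyMeasurable_inv_sinh _ _) hbd hw).differentiableWithinAt) hU
  have h2 : AnalyticOnNhd ℂ (fun z => -2 * I * logistic z) {z : ℂ | |z.im| < Real.pi} :=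
    fun w hw => analyticAt_const.mul (analyticAt_logistic hw)
  refine h1.eqOn_of_preconnected_of_frequently_eq h2 (convex_strip _).isPreconnected (z₀ := 0)
    (by simpa using Real.pi_pos) ?_ hz
  have hf : ∃ᶠ y : ℝ in 𝓝[≠] 0, lineIntegral ε (fun x => (sinh (Real.pi * linePt ε x))⁻¹) y =
      -2 * I * logistic y :=
    (Eventually.of_forall fun y => lineIntegral_inv_sinh_ofReal hε h y).frequently
  have ht : Tendsto (fun y : ℝ => (y : ℂ)) (𝓝[≠] 0) (𝓝[≠] 0) := by
    refine tendsto_nhdsWithin_of_tendsto_nhds_of_eventually_within _ ?_ ?_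
    · exact (continuous_ofReal.tendsto' 0 0 (by simp)).mono_left nhdsWithin_le_nhds
    · filter_upwards [self_mem_nhdsWithin] with y hy
      simpa using hy
  exact ht.frequently hf

/-! ### Superpositions of exponentials against `1 / sinh` -/

section Superposition

variable {X : Type*} [MeasurableSpace X] {μ : Measure X} {ε : ℝ} {w c : X → ℝ}

/-- The superposition `∫ w e^(iuc)` of exponentials, at the point `u = x + iε`. -/
def superposition (μ : Measure X) (ε : ℝ) (w c : X → ℝ) (x : ℝ) : ℂ :=
  ∫ a, w a * exp (I * linePt ε x * c a) ∂μ

lemma norm_exp_I_mul_linePt (ε x r : ℝ) :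
    ‖exp (I * linePt ε x * r)‖ = Real.exp (-(ε * r)) := by
  rw [norm_exp]
  simp

lemma norm_superposition_le (x : ℝ) :
    ‖superposition μ ε w c x‖ ≤ ∫ a, |w a| * Real.exp (-(ε * c a)) ∂μ := by
  refine (norm_integral_le_integral_norm _).trans (le_of_eq ?_)
  congr 1 with a
  rw [norm_mul, norm_exp_I_mul_linePt, norm_real, Real.norm_eq_abs]

lemma aestronglyMeasurable_superposition [SFinite μ] (hw : Measurable w) (hc : Measurable c) :
    AEStronglyMeasurable (superposition μ ε w c) := by
  apply StronglyMeasurable.aestronglyMeasurable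
  apply StronglyMeasurable.integral_prod_right
  apply Measurable.stronglyMeasurable
  unfold Function.uncurry
  fun_prop

lemma norm_inv_sinh_mul_superposition_le (hε : 0 < ε) (h : ε < 1) (x : ℝ) :
    ‖(sinh (Real.pi * linePt ε x))⁻¹ * superposition μ ε w c x‖ ≤
      (2 / Real.sin (Real.pi * ε) * ∫ a, |w a| * Real.exp (-(ε * c a)) ∂μ) *
        Real.exp (-(Real.pi * |x|)) := by
  have hpε : Real.pi * ε < Real.pi := by nlinarith [Real.pi_pos]
  have h1 := norm_inv_sinh_linePt_le Real.pi_pos hε hpε x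
  have h2 := sin_mul_pos Real.pi_pos hε hpε
  rw [norm_mul]
  refine (mul_le_mul h1 (norm_superposition_le x) (norm_nonneg _) (by positivity)).trans
    (le_of_eq (by ring))

lemma integrable_lineIntegral_superposition [SFinite μ] (hε : 0 < ε) (h : ε < 1) (hw : Measurable w)
    (hc : Measurable c) {z : ℂ} (hz : |z.im| < Real.pi) :
    Integrable fun x : ℝ => exp (-I * linePt ε x * z) *
      ((sinh (Real.pi * linePt ε x))⁻¹ * superposition μ ε w c x) :=
  integrable_lineIntegral ((aestronglyMeasurable_inv_sinh _ _).mul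
    (aestronglyMeasurable_superposition hw hc)) (norm_inv_sinh_mul_superposition_le hε h) hz

/-- The factor `e^(iuc)` replaces `z` by the translate `z - c`. On the line its modulus is
`e^(-εc)`, independent of `x`, so the double integrand is dominated by a product and Fubini applies.
-/
lemma lineIntegral_superposition [SFinite μ] (hε : 0 < ε) (h : ε < 1) (hw : Measurable w) (hc : Measurable c)
    (hi : Integrable (fun a => |w a| * Real.exp (-(ε * c a))) μ) {z : ℂ} (hz : |z.im| < Real.pi) :
    lineIntegral ε (fun x => (sinh (Real.pi * linePt ε x))⁻¹ * superposition μ ε w c x) z =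
      ∫ a, w a * (-2 * I * logistic (z - c a)) ∂μ := by
  have hpε : Real.pi * ε < Real.pi := by nlinarith [Real.pi_pos]
  have hbd := norm_inv_sinh_linePt_le Real.pi_pos hε hpε
  have hA := integrable_lineIntegral (ε := ε) (aestronglyMeasurable_inv_sinh Real.pi ε) hbd hz
  have hF : Integrable (Function.uncurry fun (x : ℝ) (a : X) =>
      (exp (-I * linePt ε x * z) * (sinh (Real.pi * linePt ε x))⁻¹) *
        (w a * exp (I * linePt ε x * c a))) (volume.prod μ) := by
    refine (hA.norm.mul_prod hi).mono ?_ (.of_forall fun p => le_of_eq ?_)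
    · apply Measurable.aestronglyMeasurable
      unfold Function.uncurry
      fun_prop
    · simp only [Function.uncurry]
      rw [norm_mul, norm_mul (w p.2 : ℂ), norm_exp_I_mul_linePt, norm_mul _ (_ * _), norm_norm,
        Real.norm_of_nonneg (by positivity : 0 ≤ |w p.2| * Real.exp (-(ε * c p.2))), norm_real,
        Real.norm_eq_abs]
  have : lineIntegral ε (fun x => (sinh (Real.pi * linePt ε x))⁻¹ * superposition μ ε w c x) z =
      ∫ x : ℝ, ∫ a, (exp (-I * linePt ε x * z) * (sinh (Real.pi * linePt ε x))⁻¹) *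
        (w a * exp (I * linePt ε x * c a)) ∂μ := by
    simp only [lineIntegral, superposition, integral_const_mul, mul_assoc]
  rw [this, integral_integral_swap hF]
  congr 1 with a
  rw [← lineIntegral_inv_sinh hε h (by simpa using hz), lineIntegral, ← integral_const_mul]
  congr 1 with x
  rw [show -I * linePt ε x * (z - c a) = -I * linePt ε x * z + I * linePt ε x * c a by ring, exp_add]
  ring

end Superposition

/-! ### The powers `1/u` and `1/u²` as superpositions -/

lemma integral_Ioi_exp_linePt {ε : ℝ} (hε : 0 < ε) (x : ℝ) :
    superposition (volume.restrict (Set.Ioi 0)) ε (fun _ => 1) id x = I / linePt ε x := by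
  have h := integral_exp_mul_complex_Ioi (a := I * linePt ε x) (by simpa using hε) 0
  have h0 := linePt_ne_zero hε x
  simp only [superposition, ofReal_one, one_mul, id]
  rw [h, ofReal_zero, mul_zero, exp_zero]
  field_simp
  rw [I_sq]

lemma integrableOn_pow_mul_exp_neg {ε : ℝ} (hε : 0 < ε) (p : ℕ) :
    IntegrableOn (fun r : ℝ => |r ^ p| * Real.exp (-(ε * r))) (Set.Ioi 0) := by
  have := integrableOn_rpow_mul_exp_neg_mul_rpow (s := p) (p := 1) (b := ε)
    (by linarith [(Nat.cast_nonneg p : (0 : ℝ) ≤ p)]) one_pos hε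
  refine this.congr_fun (fun r hr => ?_) measurableSet_Ioi
  have hr' : (0 : ℝ) ≤ r := le_of_lt hr
  simp [abs_of_nonneg (pow_nonneg hr' p)]

lemma integral_Ioi_mul_exp_linePt {ε : ℝ} (hε : 0 < ε) (x : ℝ) :
    superposition (volume.restrict (Set.Ioi 0)) ε id id x = -(1 / linePt ε x ^ 2) := by
  have h0 := linePt_ne_zero hε x
  set κ := I * linePt ε x with hκ
  have hκ0 : κ ≠ 0 := mul_ne_zero I_ne_zero h0
  have hn : ∀ r : ℝ, ‖exp (κ * r)‖ = Real.exp (-(ε * r)) := norm_exp_I_mul_linePt ε x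
  have hd : ∀ r : ℝ, HasDerivAt (fun r : ℝ => (r : ℂ) * (exp (κ * r) / κ) - exp (κ * r) / κ ^ 2)
      (r * exp (κ * r)) r := by
    intro r
    have h1 : HasDerivAt (fun r : ℝ => (r : ℂ)) 1 r := by
      simpa using (HasDerivAt.ofReal_comp (hasDerivAt_id r))
    have h2 : HasDerivAt (fun r : ℝ => exp (κ * r)) (exp (κ * r) * κ) r := by
      simpa using (h1.const_mul κ).cexp
    convert! (h1.mul (h2.div_const κ)).sub (h2.div_const (κ ^ 2)) using 1
    field_simp
    ring
  simp only [superposition, id]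
  have ht : ∀ p : ℕ, Tendsto (fun r : ℝ => (r : ℂ) ^ p * exp (κ * r)) atTop (𝓝 0) := by
    intro p
    refine squeeze_zero_norm' ?_ (tendsto_rpow_mul_exp_neg_mul_atTop_nhds_zero p ε hε)
    filter_upwards [eventually_ge_atTop 0] with r hr
    rw [norm_mul, hn, norm_pow, norm_real, Real.norm_of_nonneg hr, Real.rpow_natCast, neg_mul]
  rw [integral_Ioi_of_hasDerivAt_of_tendsto' (fun r _ => hd r) ?_ (m := 0)]
  · simp [hκ, mul_pow]
  · have h1 := ((ht 1).div_const κ).sub ((ht 0).div_const (κ ^ 2))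
    simpa [mul_div_assoc] using h1
  · refine (integrableOn_pow_mul_exp_neg hε 1).mono'
      (Measurable.aestronglyMeasurable (by fun_prop)) (.of_forall fun r => le_of_eq ?_)
    rw [norm_mul, hn, norm_real, pow_one, Real.norm_eq_abs]

/-- Equivalently, `∫ e^(-iuz) / (2 u sinh(πu)) du = -log(1 + e^z)`. -/
lemma lineIntegral_inv_mul_inv_sinh {ε : ℝ} (hε : 0 < ε) (h : ε < 1) {z : ℂ}
    (hz : |z.im| < Real.pi) :
    lineIntegral ε (fun x => (sinh (Real.pi * linePt ε x))⁻¹ * (I / linePt ε x)) z =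
      -2 * I * log (1 + exp z) := by
  have := lineIntegral_superposition (μ := volume.restrict (Set.Ioi (0 : ℝ))) (w := fun _ => 1)
    (c := id) hε h (by fun_prop) (by fun_prop) ?_ hz
  · simp only [integral_Ioi_exp_linePt hε] at this
    rw [this]
    simp only [id, ofReal_one, one_mul]
    rw [integral_const_mul, integral_logistic_sub hz]
  · simpa [IntegrableOn] using integrableOn_pow_mul_exp_neg hε 0

lemma lineIntegral_sq_inv_mul_inv_sinh {ε : ℝ} (hε : 0 < ε) (h : ε < 1) {z : ℂ}
    (hz : |z.im| < Real.pi) :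
    lineIntegral ε (fun x => (sinh (Real.pi * linePt ε x))⁻¹ * -(1 / linePt ε x ^ 2)) z =
      2 * I * dilog (-exp z) := by
  have := lineIntegral_superposition (μ := volume.restrict (Set.Ioi (0 : ℝ))) (w := id)
    (c := id) hε h (by fun_prop) (by fun_prop) ?_ hz
  · simp only [integral_Ioi_mul_exp_linePt hε] at this
    rw [this]
    simp only [id, mul_left_comm _ (-2 * I)]
    rw [integral_const_mul, integral_mul_logistic_sub hz]
    ring
  · simpa [IntegrableOn] using integrableOn_pow_mul_exp_neg hε 1

/-! ### Laplace weights and the Mittag-Leffler expansion -/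

/-- The weight `(-1)^m e^(-ξ/τ) / m^2`, `m = n + 1`. -/
def laplaceWeight (τ : ℝ) (p : ℕ × ℝ) : ℝ :=
  (-1) ^ (p.1 + 1) / ((p.1 : ℝ) + 1) ^ 2 * Real.exp (-(p.2 / τ))

lemma summable_one_div_add_one_sq : Summable fun n : ℕ => 1 / ((n : ℝ) + 1) ^ 2 := by
  have := (summable_nat_add_iff 1).2 (Real.summable_one_div_nat_pow.2 one_lt_two)
  simpa using this

/-- For negative `s` the exponential grows, but at most like `e^(εξ)`; the Laplace factor wins
because `ε < 1/τ`. The sum over `m` converges by `1/m²`. -/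
lemma integrable_laplaceWeight {τ ε s : ℝ} (hτ : 0 < τ) (hε : 0 < ε) (hετ : ε * τ < 1)
    (hs : |s| ≤ 1) :
    Integrable (fun p : ℕ × ℝ => |laplaceWeight τ p| * Real.exp (-(ε * (s * p.2 / (p.1 + 1)))))
      (Measure.count.prod (volume.restrict (Set.Ioi 0))) := by
  have h1 : Integrable (fun n : ℕ => 1 / ((n : ℝ) + 1) ^ 2) Measure.count := by
    rw [integrable_count_iff]
    exact summable_one_div_add_one_sq.norm
  have h2 : IntegrableOn (fun ξ : ℝ => Real.exp (-(1 / τ - ε) * ξ)) (Set.Ioi 0) :=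
    integrableOn_exp_mul_Ioi (by
      rw [neg_lt_zero, sub_pos, lt_div_iff₀ hτ]; exact hετ) 0
  refine (h1.mul_prod h2).mono' ?_ ?_
  · apply Measurable.aestronglyMeasurable
    unfold laplaceWeight
    fun_prop
  · have : ∀ᵐ p : ℕ × ℝ ∂(Measure.count.prod (volume.restrict (Set.Ioi (0 : ℝ)))), 0 < p.2 := by
      rw [Measure.ae_prod_iff_ae_ae (measurableSet_lt measurable_const measurable_snd)]
      exact .of_forall fun n => ae_restrict_mem measurableSet_Ioi
    filter_upwards [this] with p hp
    rw [Real.norm_of_nonneg (by positivity), laplaceWeight, abs_mul, abs_div, abs_pow, abs_neg,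
      abs_one, one_pow, abs_of_pos (Real.exp_pos _), abs_of_nonneg (by positivity), mul_assoc,
      ← Real.exp_add]
    gcongr
    have hm : (1 : ℝ) ≤ p.1 + 1 := by linarith [(Nat.cast_nonneg p.1 : (0 : ℝ) ≤ p.1)]
    have : -(s * p.2 / (p.1 + 1)) ≤ p.2 := by
      rw [← neg_div, div_le_iff₀ (by linarith)]
      have := neg_le_of_abs_le hs
      nlinarith [mul_le_mul_of_nonneg_left hm hp.le]
    have := mul_le_mul_of_nonneg_left this hε.le
    have e : -(1 / τ - ε) * p.2 = -(p.2 / τ) + ε * p.2 := by ring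
    rw [e]
    linarith

lemma hasSum_integral_count {f : ℕ → ℂ} (hf : Integrable f Measure.count) :
    HasSum f (∫ n, f n ∂Measure.count) := by
  have h := hf
  rw [integrable_count_iff] at h
  rw [integral_countable hf]
  simpa using h.of_norm.hasSum

lemma cot_sub_cot_two_mul {y : ℂ} (h : sin (2 * y) ≠ 0) :
    cot y - cot (2 * y) = 1 / sin (2 * y) := by
  have h2 := h
  rw [sin_two_mul] at h2
  have hs : sin y ≠ 0 := fun h => h2 (by simp [h])
  have hc : cos y ≠ 0 := fun h => h2 (by simp [h])
  rw [cot_eq_cos_div_sin, cot_eq_cos_div_sin, cos_two_mul, sin_two_mul]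
  field_simp
  ring

lemma mem_integerComplement_of_re {x : ℂ} (h0 : -1 < x.re) (h1 : x.re < 0) :
    x ∈ integerComplement := by
  rw [mem_integerComplement_iff]
  rintro ⟨n, hn⟩
  rw [← hn, intCast_re] at h0 h1
  have a : (-1 : ℤ) < n := by exact_mod_cast h0
  have b : n < (0 : ℤ) := by exact_mod_cast h1
  omega

lemma hasSum_cot {x : ℂ} (hx : x ∈ integerComplement) :
    HasSum (fun n : ℕ => 1 / (x - (n + 1)) + 1 / (x + (n + 1))) (Real.pi * cot (Real.pi * x) - 1 / x) := by
  rw [cot_series_rep' hx]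
  exact (summable_cotTerm hx).hasSum

/-- Mittag-Leffler expansion of `1 / sinh`. -/
lemma hasSum_inv_sinh {v : ℂ} (h0 : 0 < v.im) (h1 : v.im < 1) :
    HasSum (fun n : ℕ => (-1) ^ (n + 1) * (2 * v / (Real.pi * (v ^ 2 + ((n : ℂ) + 1) ^ 2))))
      (1 / sinh (Real.pi * v) - 1 / (Real.pi * v)) := by
  set x : ℂ := I * v with hx
  have hre : x.re = -v.im := by simp [hx]
  have hre2 : (x / 2).re = -v.im / 2 := by simp [hx]
  have hxi : x ∈ integerComplement := mem_integerComplement_of_re (by linarith) (by linarith)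
  have hx2 : x / 2 ∈ integerComplement := mem_integerComplement_of_re (by linarith) (by linarith)
  have hv : v ≠ 0 := by rintro rfl; simp at h0
  have hπ : (Real.pi : ℂ) ≠ 0 := by exact_mod_cast Real.pi_pos.ne'
  have hsin : sin (Real.pi * x) ≠ 0 := by
    intro h
    rw [sin_eq_zero_iff] at h
    obtain ⟨k, hk⟩ := h
    rw [mem_integerComplement_iff] at hxi
    exact hxi ⟨k, by rw [mul_comm (k : ℂ)] at hk; exact (mul_left_cancel₀ hπ hk).symm⟩
  -- With `x = iv`, use `1 / sin(πx) = cot(πx/2) - cot(πx)`. The cotangent series at `x/2` consists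
  -- of twice the terms of even `m` in the series at `x`, so subtraction leaves the signs `(-1)^m`.
  -- Since `m = n + 1`, even `m` means odd `n`.
  set A : ℕ → ℂ := fun n => 1 / (x - (n + 1)) + 1 / (x + (n + 1)) with hA
  have s1 : HasSum A _ := hasSum_cot hxi
  have s2 : HasSum (fun n => 2 * A (2 * n + 1))
      (Real.pi * cot (Real.pi * (x / 2)) - 1 / (x / 2)) := by
    convert hasSum_cot hx2 using 2 with n
    have e1 : x - 2 * (n + 1) ≠ 0 := by
      intro h
      rw [mem_integerComplement_iff] at hxi
      exact hxi ⟨2 * (n + 1), by push_cast; linear_combination -h⟩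
    have e2 : x + 2 * (n + 1) ≠ 0 := by
      intro h
      rw [mem_integerComplement_iff] at hxi
      exact hxi ⟨-(2 * (n + 1)), by push_cast; linear_combination -h⟩
    have d1 : x / 2 - (n + 1) = (x - 2 * (n + 1)) / 2 := by ring
    have d2 : x / 2 + (n + 1) = (x + 2 * (n + 1)) / 2 := by ring
    have d3 : x - ((2 * n + 1 : ℕ) + 1) = x - 2 * (n + 1) := by push_cast; ring
    have d4 : x + ((2 * n + 1 : ℕ) + 1) = x + 2 * (n + 1) := by push_cast; ring
    simp only [hA]
    rw [d1, d2, d3, d4]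
    field_simp
  have s3 : HasSum (fun n : ℕ => if Odd n then 2 * A n else 0)
      (Real.pi * cot (Real.pi * (x / 2)) - 1 / (x / 2)) := by
    have hinj : Function.Injective fun n : ℕ => 2 * n + 1 := fun a b h => by
      simp only at h; omega
    rw [← hinj.hasSum_iff]
    · convert s2 using 2 with n
      simp
    · intro n hn
      rw [if_neg]
      rintro ⟨k, rfl⟩
      exact hn ⟨k, rfl⟩
  have s4 := (s3.sub s1).mul_left (I / Real.pi)
  have hxsq : x ^ 2 = -v ^ 2 := by rw [hx, mul_pow, I_sq]; ring
  convert! s4 using 1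
  · funext n
    have e1 : x - (n + 1) ≠ 0 := by
      intro h
      rw [mem_integerComplement_iff] at hxi
      exact hxi ⟨(n + 1), by push_cast; linear_combination -h⟩
    have e2 : x + (n + 1) ≠ 0 := by
      intro h
      rw [mem_integerComplement_iff] at hxi
      exact hxi ⟨-(n + 1), by push_cast; linear_combination -h⟩
    have e3 : v ^ 2 + ((n : ℂ) + 1) ^ 2 = -((x - (n + 1)) * (x + (n + 1))) := by
      linear_combination hxsq
    have e4 : A n = 2 * x / ((x - (n + 1)) * (x + (n + 1))) := by
      simp only [hA]; field_simp; ring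
    have e5 : I * x = -v := by rw [hx, ← mul_assoc, I_mul_I]; ring
    have e6 : 2 * v / (Real.pi * (v ^ 2 + ((n : ℂ) + 1) ^ 2)) = I / Real.pi * A n := by
      rw [e3, e4, show I / Real.pi * (2 * x / ((x - (n + 1)) * (x + (n + 1)))) =
        2 * (I * x) / (Real.pi * ((x - (n + 1)) * (x + (n + 1)))) by field_simp, e5]
      rw [mul_neg, mul_neg, div_neg, neg_div]
    rw [e6]
    split_ifs with ho
    · rw [ho.add_one.neg_one_pow]; ring
    · rw [(Nat.not_odd_iff_even.1 ho).add_one.neg_one_pow]; ring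
  · have hc := cot_sub_cot_two_mul (y := Real.pi * (x / 2)) (by
      rwa [show 2 * (Real.pi * (x / 2)) = Real.pi * x by ring])
    rw [show 2 * (Real.pi * (x / 2)) = Real.pi * x by ring] at hc
    have hc' : cot (Real.pi * (x / 2)) = 1 / sin (Real.pi * x) + cot (Real.pi * x) := by
      rw [← hc]; ring
    have hs : sin (Real.pi * x) = sinh (Real.pi * v) * I := by
      rw [hx, show Real.pi * (I * v) = Real.pi * v * I by ring, sin_mul_I]
    have hsh : sinh (Real.pi * v) ≠ 0 := fun h => hsin (by rw [hs, h, zero_mul])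
    rw [hc', hs, hx]
    have hI := I_ne_zero
    field_simp
    ring

/-! ### Laplace integrals of the superposed exponentials -/

section

variable {τ ε s : ℝ}

/-- The scale `s ξ / m`, `m = n + 1`. -/
abbrev laplaceScale (s : ℝ) (p : ℕ × ℝ) : ℝ := s * p.2 / (p.1 + 1)

lemma measurable_laplaceWeight (τ : ℝ) : Measurable (laplaceWeight τ) := by
  unfold laplaceWeight
  fun_prop

lemma integral_Ioi_laplace (hτ : 0 < τ) (hε : 0 < ε) (hετ : ε * τ < 1) (hs : |s| ≤ 1)
    (n : ℕ) (x : ℝ) :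
    ∫ ξ in Set.Ioi (0 : ℝ), (laplaceWeight τ (n, ξ) : ℂ) *
      exp (I * linePt ε x * (laplaceScale s (n, ξ) : ℝ)) =
      (-1) ^ (n + 1) / ((n : ℂ) + 1) ^ 2 * (1 / (1 / τ - I * linePt ε x * s / (n + 1))) := by
  set a : ℂ := -(1 / τ - I * linePt ε x * s / (n + 1)) with ha
  have hm : (1 : ℝ) ≤ n + 1 := by linarith [(Nat.cast_nonneg n : (0 : ℝ) ≤ n)]
  have hre : a.re = -(1 / τ) - ε * (s / (n + 1)) := by
    have : I * linePt ε x * s / (n + 1) = I * linePt ε x * ((s / (n + 1) : ℝ) : ℂ) := by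
      push_cast; ring
    rw [ha, this, neg_re, sub_re, re_mul_ofReal, ← ofReal_one, ← ofReal_div, ofReal_re]
    simp; ring
  have hneg : a.re < 0 := by
    rw [hre]
    have h1 : -1 ≤ s / (n + 1) := by
      rw [le_div_iff₀ (by linarith)]; linarith [neg_le_of_abs_le hs]
    have h2 : ε < 1 / τ := by rwa [lt_div_iff₀ hτ]
    nlinarith
  have h := integral_exp_mul_complex_Ioi hneg 0
  rw [ofReal_zero, mul_zero, exp_zero] at h
  have e : ∀ ξ : ℝ, (laplaceWeight τ (n, ξ) : ℂ) *
      exp (I * linePt ε x * (laplaceScale s (n, ξ) : ℝ)) =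
      (-1) ^ (n + 1) / ((n : ℂ) + 1) ^ 2 * exp (a * ξ) := by
    intro ξ
    simp only [laplaceWeight, laplaceScale]
    push_cast
    rw [mul_assoc, ← exp_add]
    congr 2
    rw [ha]
    ring
  simp only [e]
  rw [integral_const_mul, h, ha, neg_div_neg_eq]

lemma hasSum_superposition_laplace (hτ : 0 < τ) (hε : 0 < ε) (hετ : ε * τ < 1) (hs : |s| ≤ 1)
    (x : ℝ) :
    HasSum (fun n : ℕ =>
      (-1) ^ (n + 1) / ((n : ℂ) + 1) ^ 2 * (1 / (1 / τ - I * linePt ε x * s / (n + 1))))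
      (superposition (Measure.count.prod (volume.restrict (Set.Ioi 0))) ε (laplaceWeight τ)
        (laplaceScale s) x) := by
  have hi : Integrable (fun p : ℕ × ℝ => (laplaceWeight τ p : ℂ) *
      exp (I * linePt ε x * (laplaceScale s p : ℝ)))
      (Measure.count.prod (volume.restrict (Set.Ioi 0))) := by
    refine (integrable_laplaceWeight hτ hε hετ hs).mono' ?_ (.of_forall fun p => le_of_eq ?_)
    · have := measurable_laplaceWeight τ
      apply Measurable.aestronglyMeasurable
      fun_prop
    · rw [norm_mul, norm_exp_I_mul_linePt, norm_real, Real.norm_eq_abs]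
  have h := hasSum_integral_count hi.integral_prod_left
  rw [← integral_prod _ hi] at h
  simpa only [integral_Ioi_laplace hτ hε hετ hs, superposition] using h

lemma norm_neg_one_pow_div_sq (n : ℕ) :
    ‖(-1) ^ (n + 1) / ((n : ℂ) + 1) ^ 2‖ = 1 / ((n : ℝ) + 1) ^ 2 := by
  have hn : ‖(n : ℂ) + 1‖ = n + 1 := by
    have : (n : ℂ) + 1 = ((n + 1 : ℝ) : ℂ) := by push_cast; rfl
    rw [this, norm_real, Real.norm_of_nonneg (by positivity)]
  rw [norm_div, norm_pow, norm_neg, norm_one, one_pow, norm_pow, hn]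

lemma norm_logistic_laplace_le {z : ℂ} (hz : |z.im| < Real.pi) (r : ℝ) (n : ℕ) :
    ‖(-1) ^ (n + 1) / ((n : ℂ) + 1) ^ 2 * logistic (z - r / (n + 1))‖ ≤
      1 / ((n : ℝ) + 1) ^ 2 * (1 / Real.cos (z.im / 2)) := by
  have e : z - r / (n + 1) = z - ((r / (n + 1) : ℝ) : ℂ) := by push_cast; rfl
  have h := norm_logistic_le (w := z - ((r / (n + 1) : ℝ) : ℂ))
    (by rwa [sub_im, ofReal_im, sub_zero])
  rw [sub_im, ofReal_im, sub_zero] at h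
  rw [e, norm_mul, norm_neg_one_pow_div_sq]
  gcongr

lemma summable_logistic_laplace {z : ℂ} (hz : |z.im| < Real.pi) (r : ℝ) :
    Summable fun n : ℕ => ‖(-1) ^ (n + 1) / ((n : ℂ) + 1) ^ 2 * logistic (z - r / (n + 1))‖ :=
  Summable.of_nonneg_of_le (fun _ => norm_nonneg _) (norm_logistic_laplace_le hz r)
    (summable_one_div_add_one_sq.mul_right (1 / Real.cos (z.im / 2)))

lemma integral_superposed_logistic (hτ : 0 < τ) {z : ℂ} (hz : |z.im| < Real.pi) :
    ∫ p, (laplaceWeight τ p : ℂ) * (-2 * I * logistic (z - (laplaceScale s p : ℝ)))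
      ∂(Measure.count.prod (volume.restrict (Set.Ioi 0))) =
    -2 * I * ∫ ξ in Set.Ioi (0 : ℝ), exp (-(ξ / τ : ℝ)) *
      ∑' n : ℕ, (-1) ^ (n + 1) / ((n : ℂ) + 1) ^ 2 * logistic (z - s * ξ / (n + 1)) := by
  have hi : Integrable (fun p : ℕ × ℝ => (laplaceWeight τ p : ℂ) *
      (-2 * I * logistic (z - (laplaceScale s p : ℝ))))
      (Measure.count.prod (volume.restrict (Set.Ioi 0))) := by
    -- The translates of the logistic function are bounded, so only integrability of the bare weight
    -- is needed: `s = 0` removes the exponential, and `1/(2τ)` is merely an admissible height.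
    have h0 := integrable_laplaceWeight (s := 0) (ε := 1 / (2 * τ)) hτ (by positivity)
      (by field_simp; norm_num) (by simp)
    simp only [zero_mul, zero_div, mul_zero, neg_zero, Real.exp_zero, mul_one] at h0
    refine (h0.mul_const (2 * (1 / Real.cos (z.im / 2)))).mono' ?_ (.of_forall fun p => ?_)
    · have := measurable_laplaceWeight τ
      apply Measurable.aestronglyMeasurable
      unfold logistic
      fun_prop
    · have h := norm_logistic_le (w := z - (laplaceScale s p : ℝ))
        (by rwa [sub_im, ofReal_im, sub_zero])
      rw [sub_im, ofReal_im, sub_zero] at h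
      rw [norm_mul, norm_mul, norm_mul, norm_real, Real.norm_eq_abs]
      simp only [norm_neg, norm_I, mul_one, Complex.norm_ofNat]
      gcongr
  rw [integral_prod_symm _ hi, ← integral_const_mul]
  congr 1 with ξ
  have hsum := summable_logistic_laplace hz (s * ξ)
  have e : ∀ n : ℕ, (laplaceWeight τ (n, ξ) : ℂ) *
      (-2 * I * logistic (z - (laplaceScale s (n, ξ) : ℝ))) =
      (-2 * I * exp (-(ξ / τ : ℝ))) * ((-1) ^ (n + 1) / ((n : ℂ) + 1) ^ 2 *
        logistic (z - (s * ξ : ℝ) / (n + 1))) := by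
    intro n
    simp only [laplaceWeight, laplaceScale]
    push_cast
    ring
  simp only [e]
  rw [integral_const_mul, ← (hasSum_integral_count (integrable_count_iff.2 hsum)).tsum_eq]
  push_cast
  ring

end

/-- The analytic continuation of the Borel transform of `phiHat z`. -/
def borelG (z ξ : ℂ) : ℂ :=
  1 / (2 * Real.pi * I) * ∑' n : ℕ, (-1) ^ (n + 1) / ((n : ℂ) + 1) ^ 2 *
    (logistic (z + ξ / (n + 1)) + logistic (z - ξ / (n + 1)))

/-- The contributions of `s = ±1` are simple fractions in `u`; for each `m` they add up to `2τ
(-1)^m / (m² + τ²u²)`, which is `π/u` times the Mittag-Leffler term at `v = τu`. -/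
lemma superposition_laplace_add {τ ε : ℝ} (hτ : 0 < τ) (hε : 0 < ε) (hετ : ε * τ < 1) (x : ℝ) :
    superposition (Measure.count.prod (volume.restrict (Set.Ioi 0))) ε (laplaceWeight τ)
        (laplaceScale 1) x +
      superposition (Measure.count.prod (volume.restrict (Set.Ioi 0))) ε (laplaceWeight τ)
        (laplaceScale (-1)) x =
    Real.pi / linePt ε x * (1 / sinh (Real.pi * (τ * linePt ε x)) -
      1 / (Real.pi * (τ * linePt ε x))) := by
  have h1 := hasSum_superposition_laplace (s := 1) hτ hε hετ (by simp) x
  have h2 := hasSum_superposition_laplace (s := -1) hτ hε hετ (by simp) x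
  have h3 := (hasSum_inv_sinh (v := τ * linePt ε x) (by simpa using mul_pos hτ hε)
    (by simpa [mul_comm] using hετ)).mul_left (Real.pi / linePt ε x)
  refine (h1.add h2).unique ?_
  convert! h3 using 2 with n
  set u := linePt ε x with hu
  have hu0 : u ≠ 0 := linePt_ne_zero hε x
  have hm : (1 : ℝ) ≤ n + 1 := by linarith [(Nat.cast_nonneg n : (0 : ℝ) ≤ n)]
  have hm0 : ((n : ℂ) + 1) ≠ 0 := Nat.cast_add_one_ne_zero n
  have hτ0 : (τ : ℂ) ≠ 0 := by exact_mod_cast hτ.ne'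
  have hπ : (Real.pi : ℂ) ≠ 0 := by exact_mod_cast Real.pi_pos.ne'
  have hA : ((n : ℂ) + 1) - I * (τ * u) ≠ 0 := by
    intro h
    have := congrArg Complex.re h
    simp [hu] at this
    nlinarith [mul_pos hτ hε]
  have hB : ((n : ℂ) + 1) + I * (τ * u) ≠ 0 := by
    intro h
    have := congrArg Complex.re h
    simp [hu] at this
    nlinarith [mul_pos hτ hε]
  have e1 : (1 / τ - I * u * (1 : ℝ) / (n + 1) : ℂ) =
      (((n : ℂ) + 1) - I * (τ * u)) / (τ * (n + 1)) := by
    push_cast; field_simp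
  have e2 : (1 / τ - I * u * (-1 : ℝ) / (n + 1) : ℂ) =
      (((n : ℂ) + 1) + I * (τ * u)) / (τ * (n + 1)) := by
    push_cast; field_simp; ring
  have e3 : (τ * u) ^ 2 + ((n : ℂ) + 1) ^ 2 =
      (((n : ℂ) + 1) - I * (τ * u)) * (((n : ℂ) + 1) + I * (τ * u)) := by
    linear_combination (τ * u) ^ 2 * I_sq
  rw [e1, e2, e3]
  generalize hgA : ((n : ℂ) + 1) - I * (τ * u) = A at *
  generalize hgB : ((n : ℂ) + 1) + I * (τ * u) = B at *
  have hAB : B + A = 2 * (n + 1) := by rw [← hgA, ← hgB]; ring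
  field_simp
  rw [hAB]
  ring

/-! ### Faddeev's integral as dilogarithm plus Laplace integral -/

/-- The rescaled Faddeev integral. -/
def faddeevLog (τ ε : ℝ) (z : ℂ) : ℂ :=
  lineIntegral ε (fun x => (4 * sinh (Real.pi * τ * linePt ε x) * sinh (Real.pi * linePt ε x) *
    linePt ε x)⁻¹) z

lemma integrable_laplace_logistic {τ : ℝ} (hτ : 0 < τ) {z : ℂ} (hz : |z.im| < Real.pi) (s : ℝ) :
    IntegrableOn (fun ξ : ℝ => exp (-(ξ / τ : ℝ)) *
      ∑' n : ℕ, (-1) ^ (n + 1) / ((n : ℂ) + 1) ^ 2 * logistic (z - s * ξ / (n + 1)))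
      (Set.Ioi 0) := by
  have h2 : IntegrableOn (fun ξ : ℝ => Real.exp (-(1 / τ) * ξ)) (Set.Ioi 0) :=
    integrableOn_exp_mul_Ioi (by rw [neg_lt_zero]; positivity) 0
  refine (h2.mul_const (∑' n : ℕ, 1 / ((n : ℝ) + 1) ^ 2 * (1 / Real.cos (z.im / 2)))).mono' ?_
    (.of_forall fun ξ => ?_)
  · apply Measurable.aestronglyMeasurable
    unfold logistic
    fun_prop
  · rw [norm_mul, norm_exp]
    refine mul_le_mul (le_of_eq (by rw [neg_re, ofReal_re]; ring_nf)) ?_ (norm_nonneg _) (Real.exp_pos _).le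
    have hs := (summable_one_div_add_one_sq.mul_right (1 / Real.cos (z.im / 2))).hasSum
    refine tsum_of_norm_bounded hs fun n => ?_
    simpa using norm_logistic_laplace_le hz (s * ξ) n

lemma borelG_ofReal {z : ℂ} (hz : |z.im| < Real.pi) (ξ : ℝ) :
    borelG z ξ = 1 / (2 * Real.pi * I) *
      ((∑' n : ℕ, (-1) ^ (n + 1) / ((n : ℂ) + 1) ^ 2 * logistic (z - (1 : ℝ) * ξ / (n + 1))) +
      ∑' n : ℕ, (-1) ^ (n + 1) / ((n : ℂ) + 1) ^ 2 * logistic (z - (-1 : ℝ) * ξ / (n + 1))) := by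
  have h1 := (summable_logistic_laplace hz ξ).of_norm
  have h2 := (summable_logistic_laplace hz (-ξ)).of_norm
  rw [borelG]
  push_cast at h2
  push_cast
  simp only [one_mul, neg_mul]
  rw [← h1.tsum_add h2]
  congr 2 with n
  rw [neg_div, sub_neg_eq_add]
  ring

lemma norm_one_div_linePt_le {ε : ℝ} (hε : 0 < ε) (x : ℝ) : ‖1 / linePt ε x‖ ≤ 1 / ε := by
  rw [norm_div, norm_one]
  gcongr
  have := abs_im_le_norm (linePt ε x)
  simpa [abs_of_pos hε] using this

lemma faddeevLog_eq {τ ε : ℝ} (hτ : 0 < τ) (hε : 0 < ε) (hε1 : ε < 1) (hετ : ε * τ < 1) {z : ℂ}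
    (hz : |z.im| < Real.pi) :
    faddeevLog τ ε z = dilog (-exp z) / (2 * Real.pi * I * τ) +
      ∫ ξ in Set.Ioi (0 : ℝ), exp (-(ξ / τ : ℝ)) * borelG z ξ := by
  set ν : Measure (ℕ × ℝ) := Measure.count.prod (volume.restrict (Set.Ioi 0))
  have hwm := measurable_laplaceWeight τ
  have hcm : ∀ s, Measurable (laplaceScale s) := fun s => by fun_prop
  have L : ∀ s : ℝ, |s| ≤ 1 → _ := fun s hs => (lineIntegral_superposition (μ := ν) hε hε1 hwm
    (hcm s) (integrable_laplaceWeight hτ hε hετ hs) hz).trans (integral_superposed_logistic hτ hz)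
  have L1 := L 1 (by simp)
  have L2 := L (-1) (by simp)
  have J1 := integrable_lineIntegral_superposition (μ := ν) hε hε1 hwm (hcm 1) hz
  have J2 := integrable_lineIntegral_superposition (μ := ν) hε hε1 hwm (hcm (-1)) hz
  have L0 := lineIntegral_sq_inv_mul_inv_sinh hε hε1 hz
  have J0 := integrable_lineIntegral_superposition (μ := volume.restrict (Set.Ioi (0 : ℝ)))
    (w := id) (c := id) hε hε1 (by fun_prop) (by fun_prop) hz
  simp only [integral_Ioi_mul_exp_linePt hε] at J0
  have hτ0 : (τ : ℂ) ≠ 0 := by exact_mod_cast hτ.ne'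
  have hπ : (Real.pi : ℂ) ≠ 0 := by exact_mod_cast Real.pi_pos.ne'
  have hI := I_ne_zero
  have hpε : Real.pi * ε < Real.pi := by nlinarith [Real.pi_pos]
  have hpτε : Real.pi * τ * ε < Real.pi := by nlinarith [Real.pi_pos]
  -- The kernel splits according to `1 / sinh(πτu) = 1 / (πτu) + (1 / sinh(πτu) - 1 / (πτu))`; the
  -- bracket is supplied by `superposition_laplace_add`.
  have key : faddeevLog τ ε z =
      (-(1 / (4 * Real.pi * τ)) : ℂ) * lineIntegral ε (fun x => (sinh (Real.pi * linePt ε x))⁻¹ *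
        -(1 / linePt ε x ^ 2)) z +
      (1 / (4 * Real.pi)) * (lineIntegral ε (fun x => (sinh (Real.pi * linePt ε x))⁻¹ *
        superposition ν ε (laplaceWeight τ) (laplaceScale 1) x) z +
        lineIntegral ε (fun x => (sinh (Real.pi * linePt ε x))⁻¹ *
        superposition ν ε (laplaceWeight τ) (laplaceScale (-1)) x) z) := by
    simp only [faddeevLog, lineIntegral]
    have J12 := J1.add J2
    rw [Pi.add_def] at J12
    rw [← integral_add J1 J2, ← integral_const_mul, ← integral_const_mul,
      ← integral_add (J0.const_mul _) (J12.const_mul _)]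
    congr 1 with x
    rw [← mul_add, ← mul_add, superposition_laplace_add hτ hε hετ x]
    have h0 := linePt_ne_zero hε x
    have h1 := sinh_linePt_ne_zero Real.pi_pos hε hpε x
    have h2 := sinh_linePt_ne_zero (mul_pos Real.pi_pos hτ) hε hpτε x
    push_cast at h2
    rw [← mul_assoc (Real.pi : ℂ) τ]
    generalize exp (-I * linePt ε x * z) = E
    generalize sinh (Real.pi * τ * linePt ε x) = S at *
    generalize sinh (Real.pi * linePt ε x) = S' at *
    field_simp
    ring
  rw [key, L0, L1, L2, ← mul_add, ← integral_add (integrable_laplace_logistic hτ hz 1)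
    (integrable_laplace_logistic hτ hz (-1))]
  simp only [borelG_ofReal hz, ← mul_add, mul_left_comm _ (1 / (2 * (Real.pi : ℂ) * I))]
  rw [integral_const_mul]
  generalize (∫ ξ in Set.Ioi (0 : ℝ), (_ : ℂ)) = K
  field_simp
  rw [I_sq]
  ring

/-! ### The Borel transform and its continuation -/

lemma norm_logistic_le_of_abs_im_le {Y : ℝ} (hY : Y < Real.pi) {w : ℂ} (hw : |w.im| ≤ Y) :
    ‖logistic w‖ ≤ 1 / Real.cos (Y / 2) := by
  have hY0 : 0 ≤ Y := (abs_nonneg _).trans hw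
  have hcY : 0 < Real.cos (Y / 2) := Real.cos_pos_of_mem_Ioo ⟨by linarith, by linarith⟩
  refine (norm_logistic_le (hw.trans_lt hY)).trans (one_div_le_one_div_of_le hcY ?_)
  rw [← Real.cos_abs (w.im / 2)]
  apply Real.cos_le_cos_of_nonneg_of_le_pi (abs_nonneg _) (by linarith)
  rw [abs_div, abs_two]; linarith

lemma abs_im_div_le (ξ : ℂ) (n : ℕ) : |(ξ / ((n : ℂ) + 1)).im| ≤ |ξ.im| := by
  have e : ξ / ((n : ℂ) + 1) = ξ / ((n + 1 : ℝ) : ℂ) := by push_cast; rfl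
  rw [e, div_ofReal_im, abs_div]
  apply div_le_self (abs_nonneg _)
  rw [abs_of_nonneg (by positivity)]
  linarith [(Nat.cast_nonneg n : (0 : ℝ) ≤ n)]

/-- For `|Im ζ| < δ` every argument `z ± ζ/m` stays in a closed strip inside `|Im| < π`, where the
logistic function is bounded. The series thus converges uniformly on a whole strip around the real
axis. -/
lemma analyticAt_borelG {z : ℂ} (hz : |z.im| < Real.pi) (ξ : ℝ) : AnalyticAt ℂ (borelG z) ξ := by
  set δ : ℝ := (Real.pi - |z.im|) / 2 with hδ
  have hδ0 : 0 < δ := by linarith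
  have hYπ : |z.im| + δ < Real.pi := by linarith
  have him : ∀ (n : ℕ) (ζ : ℂ), |ζ.im| < δ →
      |(z + ζ / ((n : ℂ) + 1)).im| ≤ |z.im| + δ ∧ |(z - ζ / ((n : ℂ) + 1)).im| ≤ |z.im| + δ := by
    intro n ζ hζ
    have := abs_im_div_le ζ n
    rw [add_im, sub_im]
    exact ⟨(abs_add_le _ _).trans (by linarith), (abs_sub _ _).trans (by linarith)⟩
  have hU := isOpen_strip δ
  have hd : DifferentiableOn ℂ (fun ζ => ∑' n : ℕ, (-1) ^ (n + 1) / ((n : ℂ) + 1) ^ 2 *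
      (logistic (z + ζ / (n + 1)) + logistic (z - ζ / (n + 1)))) {ζ : ℂ | |ζ.im| < δ} := by
    refine differentiableOn_tsum_of_summable_norm (summable_one_div_add_one_sq.mul_right
      (1 / Real.cos ((|z.im| + δ) / 2) + 1 / Real.cos ((|z.im| + δ) / 2))) (fun n ζ hζ => ?_) hU
      fun n ζ hζ => ?_
    · obtain ⟨h1, h2⟩ := him n ζ hζ
      have d1 : DifferentiableAt ℂ (fun ζ => logistic (z + ζ / ((n : ℂ) + 1))) ζ :=
        DifferentiableAt.comp (f := fun ζ => z + ζ / ((n : ℂ) + 1)) ζ (analyticAt_logistic (h1.trans_lt hYπ)).differentiableAt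
          (by fun_prop)
      have d2 : DifferentiableAt ℂ (fun ζ => logistic (z - ζ / ((n : ℂ) + 1))) ζ :=
        DifferentiableAt.comp (f := fun ζ => z - ζ / ((n : ℂ) + 1)) ζ (analyticAt_logistic (h2.trans_lt hYπ)).differentiableAt
          (by fun_prop)
      exact ((d1.add d2).const_mul _).differentiableWithinAt
    · obtain ⟨h1, h2⟩ := him n ζ hζ
      rw [norm_mul, norm_neg_one_pow_div_sq]
      gcongr
      exact (norm_add_le _ _).trans (add_le_add (norm_logistic_le_of_abs_im_le hYπ h1)
        (norm_logistic_le_of_abs_im_le hYπ h2))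
  exact (hd.const_mul _).analyticAt (hU.mem_nhds (by simpa using hδ0))

lemma iteratedDeriv_dilog_neg_exp {z : ℂ} (hz : |z.im| < Real.pi) (n : ℕ) :
    iteratedDeriv (n + 2) (fun w => dilog (-exp w)) z = -iteratedDeriv n logistic z := by
  have e1 : deriv (fun w => dilog (-exp w)) =ᶠ[𝓝 z] fun w => -log (1 + exp w) := by
    filter_upwards [strip_mem_nhds hz] with w hw
    exact (hasDerivAt_dilog_neg_exp hw).deriv
  have e2 : deriv (deriv (fun w => dilog (-exp w))) =ᶠ[𝓝 z] fun w => -logistic w := by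
    refine e1.deriv.trans ?_
    filter_upwards [strip_mem_nhds hz] with w hw
    exact (hasDerivAt_log_one_add_exp hw).neg.deriv
  rw [iteratedDeriv_succ', iteratedDeriv_succ', e2.iteratedDeriv_eq]
  exact iteratedDeriv_neg n logistic z

/-- The Fourier series of `B_{2k}(x)` at `x = 1/2`, where `cos(2πmx) = (-1)^m`. -/
lemma hasSum_neg_one_pow_div_pow (j : ℕ) :
    HasSum (fun n : ℕ => (-1 : ℂ) ^ (n + 1) / ((n : ℂ) + 1) ^ (2 * (j + 1)))
      ((-1) ^ j * (2 * Real.pi) ^ (2 * (j + 1)) / 2 / ((2 * (j + 1)).factorial : ℂ) *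
        (((Polynomial.bernoulli (2 * (j + 1))).eval (1 / 2 : ℚ) : ℚ) : ℂ)) := by
  have h := hasSum_one_div_nat_pow_mul_cos (k := j + 1) (by omega) (x := 1 / 2)
    ⟨by norm_num, by norm_num⟩
  rw [← hasSum_nat_add_iff' 1] at h
  have h' := Complex.hasSum_ofReal.2 h
  have hB : (Polynomial.map (algebraMap ℚ ℝ) (Polynomial.bernoulli (2 * (j + 1)))).eval (1 / 2) =
      (((Polynomial.bernoulli (2 * (j + 1))).eval (1 / 2 : ℚ) : ℚ) : ℝ) := by
    rw [show (1 / 2 : ℝ) = algebraMap ℚ ℝ (1 / 2) by simp, Polynomial.eval_map_apply]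
    simp
  rw [hB] at h'
  convert h' using 1
  · funext n
    rw [show 2 * Real.pi * ((n + 1 : ℕ) : ℝ) * (1 / 2) = ((n + 1 : ℕ) : ℝ) * Real.pi by ring,
      Real.cos_nat_mul_pi]
    push_cast
    ring
  · simp [pow_add]

lemma hasSum_logistic_taylor {z h : ℂ} (hh : ‖h‖ < Real.pi - |z.im|) :
    HasSum (fun n : ℕ => iteratedDeriv n logistic z / (n.factorial : ℂ) * h ^ n)
      (logistic (z + h)) := by
  have hd : DifferentiableOn ℂ logistic (Metric.ball z (Real.pi - |z.im|)) := by
    intro w hw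
    have h1 : |(w - z).im| < Real.pi - |z.im| :=
      (abs_im_le_norm _).trans_lt (by simpa [dist_eq_norm] using hw)
    have h2 : |w.im| < Real.pi := by
      have : w.im = z.im + (w - z).im := by simp
      rw [this]
      exact (abs_add_le _ _).trans_lt (by linarith)
    exact (analyticAt_logistic h2).differentiableAt.differentiableWithinAt
  have := Complex.hasSum_taylorSeries_on_ball hd (z := z + h) (by simpa [dist_eq_norm] using hh)
  convert! this using 2 with n
  simp only [add_sub_cancel_left, smul_eq_mul]
  ring

/-- For even `k` the sum over `m` is `Σ (-1)^m / m^(k+2)`, a Bernoulli value. For odd `k` the two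
translates cancel, matching the absence of even powers of `τ` in `phiHat`. -/
lemma hasSum_borelTransform_coeff {z : ℂ} (hz : |z.im| < Real.pi) (ξ : ℂ) (k : ℕ) :
    HasSum (fun n : ℕ => (-1) ^ (n + 1) / ((n : ℂ) + 1) ^ 2 *
        (iteratedDeriv k logistic z / (k.factorial : ℂ) * (1 + (-1) ^ k) * (ξ / (n + 1)) ^ k))
      (2 * Real.pi * I * (PowerSeries.coeff k (borelTransform (phiHat z)) * ξ ^ k)) := by
  have hc : PowerSeries.coeff k (borelTransform (phiHat z)) =
      PowerSeries.coeff (k + 1) (phiHat z) / (k.factorial : ℂ) := by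
    simp [borelTransform]
  rw [hc, phiHat, PowerSeries.coeff_mk]
  rcases Nat.even_or_odd' k with ⟨j, rfl | rfl⟩
  · rw [if_pos ⟨j, rfl⟩, show 2 * j + 1 + 1 = 2 * j + 2 by ring, iteratedDeriv_dilog_neg_exp hz]
    have h := (hasSum_neg_one_pow_div_pow j).mul_left
      (2 * (iteratedDeriv (2 * j) logistic z / ((2 * j).factorial : ℂ) * ξ ^ (2 * j)))
    convert! h using 1
    · funext n
      have hm0 : ((n : ℂ) + 1) ≠ 0 := Nat.cast_add_one_ne_zero n
      rw [(even_two_mul j).neg_one_pow, div_pow, show 2 * (j + 1) = 2 * j + 2 by ring, pow_add]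
      field_simp
      ring
    · rw [show 2 * j + 2 = 2 * (j + 1) by ring]
      have hI : I ^ (2 * (j + 1)) = -(-1) ^ j := by rw [pow_mul, I_sq, pow_succ]; ring
      have e : (2 * Real.pi * I : ℂ) * (2 * Real.pi * I) ^ (2 * j + 1) =
          -(-1) ^ j * (2 * Real.pi) ^ (2 * (j + 1)) := by
        rw [← pow_succ', show 2 * j + 1 + 1 = 2 * (j + 1) by ring, mul_pow, hI]; ring
      generalize (((Polynomial.bernoulli (2 * (j + 1))).eval (1 / 2 : ℚ) : ℚ) : ℂ) = B
      generalize iteratedDeriv (2 * j) logistic z = D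
      have f1 : ((2 * j).factorial : ℂ) ≠ 0 := by exact_mod_cast (2 * j).factorial_ne_zero
      have f2 : ((2 * (j + 1)).factorial : ℂ) ≠ 0 := by
        exact_mod_cast (2 * (j + 1)).factorial_ne_zero
      field_simp
      linear_combination -B * D * ξ ^ (2 * j) * e
  · rw [if_neg (by simp [Nat.even_add_one, parity_simps])]
    have : (1 + (-1) ^ (2 * j + 1) : ℂ) = 0 := by rw [pow_succ, pow_mul]; norm_num
    simp only [this]
    simp

/-- Expand each translate in its Taylor series and exchange the sums over `m` and `k`. Since `‖ξ/m‖
≤ ‖ξ‖`, the double series is dominated by `m⁻² · 2‖c k ξ^k‖`. -/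
lemma hasSum_borelTransform {z ξ : ℂ} (hz : |z.im| < Real.pi) (hξ : ‖ξ‖ < Real.pi - |z.im|) :
    HasSum (fun k : ℕ => PowerSeries.coeff k (borelTransform (phiHat z)) * ξ ^ k)
      (borelG z ξ) := by
  set c : ℕ → ℂ := fun k => iteratedDeriv k logistic z / (k.factorial : ℂ)
  set F : ℕ × ℕ → ℂ := fun p => (-1) ^ (p.1 + 1) / ((p.1 : ℂ) + 1) ^ 2 *
    (c p.2 * (1 + (-1) ^ p.2) * (ξ / (p.1 + 1)) ^ p.2) with hF
  have hnorm : ∀ n : ℕ, ‖ξ / ((n : ℂ) + 1)‖ ≤ ‖ξ‖ := by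
    intro n
    have hn : ‖(n : ℂ) + 1‖ = n + 1 := by
      have : (n : ℂ) + 1 = ((n + 1 : ℝ) : ℂ) := by push_cast; rfl
      rw [this, norm_real, Real.norm_of_nonneg (by positivity)]
    rw [norm_div, hn]
    exact div_le_self (norm_nonneg _) (by linarith [(Nat.cast_nonneg n : (0 : ℝ) ≤ n)])
  have hcs : Summable fun k => ‖c k * ξ ^ k‖ := (hasSum_logistic_taylor hξ).summable.norm
  have hFs : Summable F := by
    refine Summable.of_norm_bounded (summable_one_div_add_one_sq.mul_of_nonneg (hcs.mul_left 2)
      (fun n => by positivity) (fun k => by positivity)) fun p => ?_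
    rw [norm_mul, norm_neg_one_pow_div_sq]
    gcongr
    rw [norm_mul, norm_mul, norm_mul, norm_pow, norm_pow, mul_comm ‖c p.2‖, mul_assoc]
    have h2 : ‖(1 + (-1) ^ p.2 : ℂ)‖ ≤ 2 := by
      refine (norm_add_le _ _).trans ?_
      rw [norm_pow, norm_neg, norm_one, one_pow]
      norm_num
    gcongr
    exact hnorm _
  have hrow : ∀ n : ℕ, HasSum (fun k => F (n, k)) ((-1) ^ (n + 1) / ((n : ℂ) + 1) ^ 2 *
      (logistic (z + ξ / (n + 1)) + logistic (z - ξ / (n + 1)))) := by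
    intro n
    have h1 := hasSum_logistic_taylor (z := z) ((hnorm n).trans_lt hξ)
    have h2 := hasSum_logistic_taylor (z := z) (h := -(ξ / (n + 1)))
      (by rw [norm_neg]; exact (hnorm n).trans_lt hξ)
    rw [← sub_eq_add_neg] at h2
    convert! (h1.add h2).mul_left ((-1) ^ (n + 1) / ((n : ℂ) + 1) ^ 2) using 2 with k
    simp only [hF]
    rw [neg_pow (ξ / ((n : ℂ) + 1))]
    ring
  have htot := hFs.hasSum.prod_fiberwise hrow
  have hcol := ((Equiv.prodComm ℕ ℕ).hasSum_iff.2 hFs.hasSum).prod_fiberwise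
    fun k => hasSum_borelTransform_coeff hz ξ k
  have h2π : (2 * Real.pi * I : ℂ) ≠ 0 := by
    simp [Real.pi_pos.ne']
  rw [borelG, htot.tsum_eq]
  convert! hcol.mul_left (1 / (2 * Real.pi * I)) using 2 with k
  field_simp

/-- The Borel sum of `phiHat z`. -/
def borelSum (τ : ℝ) (z : ℂ) : ℂ :=
  ∫ ξ in Set.Ioi (0 : ℝ), exp (-(ξ / τ : ℝ)) * borelG z ξ

lemma isBorelSum_borelSum {τ : ℝ} (hτ : 0 < τ) {z : ℂ} (hz : |z.im| < Real.pi) :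
    IsBorelSum (phiHat z) τ (borelSum τ z) := by
  refine ⟨?_, borelG z, ?_, fun ξ _ => analyticAt_borelG hz ξ, ?_, rfl⟩
  · rw [← PowerSeries.coeff_zero_eq_constantCoeff_apply, phiHat, PowerSeries.coeff_mk]
    simp
  · filter_upwards [Metric.ball_mem_nhds (0 : ℂ) (sub_pos.2 hz)] with ξ hξ
    exact hasSum_borelTransform hz (by simpa using hξ)
  · have := ((integrable_laplace_logistic hτ hz 1).add
      (integrable_laplace_logistic hτ hz (-1))).const_mul (1 / (2 * Real.pi * I))
    rw [Pi.add_def] at this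
    rw [IntegrableOn]
    simpa only [borelG_ofReal hz, ← mul_add, mul_left_comm _ (1 / (2 * (Real.pi : ℂ) * I))]
      using this

/-! ### Difference equations for Faddeev's integral and its normalization -/

section

variable {τ ε : ℝ}

/-- The kernel of the rescaled Faddeev integral. -/
abbrev faddeevKernel (τ ε x : ℝ) : ℂ :=
  (4 * sinh (Real.pi * τ * linePt ε x) * sinh (Real.pi * linePt ε x) * linePt ε x)⁻¹

lemma aestronglyMeasurable_faddeevKernel : AEStronglyMeasurable (faddeevKernel τ ε) :=
  Measurable.aestronglyMeasurable (by unfold faddeevKernel; fun_prop)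

/-- The decay rates `πτ` and `π` of the two factors add up, which accounts for the strip `|Im z| <
π(1 + τ)`. -/
lemma norm_faddeevKernel_le (hτ : 0 < τ) (hε : 0 < ε) (hε1 : ε < 1) (hετ : ε * τ < 1) (x : ℝ) :
    ‖faddeevKernel τ ε x‖ ≤ (1 / (Real.sin (Real.pi * τ * ε) * Real.sin (Real.pi * ε) * ε)) *
      Real.exp (-(Real.pi * (1 + τ) * |x|)) := by
  have hpε : Real.pi * ε < Real.pi := by nlinarith [Real.pi_pos]
  have hpτε : Real.pi * τ * ε < Real.pi := by nlinarith [Real.pi_pos]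
  have h1 := norm_inv_sinh_linePt_le Real.pi_pos hε hpε x
  have h2 := norm_inv_sinh_linePt_le (mul_pos Real.pi_pos hτ) hε hpτε x
  have h3 := norm_one_div_linePt_le hε x
  have s1 := sin_mul_pos Real.pi_pos hε hpε
  have s2 := sin_mul_pos (mul_pos Real.pi_pos hτ) hε hpτε
  rw [one_div] at h3
  push_cast at h2
  rw [faddeevKernel, mul_inv, mul_inv, mul_inv, norm_mul, norm_mul, norm_mul]
  have h4 : ‖(4 : ℂ)⁻¹‖ = 1 / 4 := by simp
  rw [h4, show -(Real.pi * (1 + τ) * |x|) = -(Real.pi * τ * |x|) + -(Real.pi * |x|) by ring,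
    Real.exp_add]
  calc _ ≤ 1 / 4 * (2 / Real.sin (Real.pi * τ * ε) * Real.exp (-(Real.pi * τ * |x|))) *
        (2 / Real.sin (Real.pi * ε) * Real.exp (-(Real.pi * |x|))) * (1 / ε) := by gcongr
    _ = _ := by field_simp; norm_num

lemma integrable_faddeevKernel (hτ : 0 < τ) (hε : 0 < ε) (hε1 : ε < 1) (hετ : ε * τ < 1) {z : ℂ}
    (hz : |z.im| < Real.pi * (1 + τ)) :
    Integrable fun x : ℝ => exp (-I * linePt ε x * z) * faddeevKernel τ ε x :=
  integrable_lineIntegral aestronglyMeasurable_faddeevKernel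
    (norm_faddeevKernel_le hτ hε hε1 hετ) hz

lemma analyticAt_faddeevLog (hτ : 0 < τ) (hε : 0 < ε) (hε1 : ε < 1) (hετ : ε * τ < 1) {z : ℂ}
    (hz : |z.im| < Real.pi * (1 + τ)) : AnalyticAt ℂ (faddeevLog τ ε) z :=
  DifferentiableOn.analyticAt (s := {z : ℂ | |z.im| < Real.pi * (1 + τ)})
    (fun _ hw => (differentiableAt_lineIntegral aestronglyMeasurable_faddeevKernel
      (norm_faddeevKernel_le hτ hε hε1 hετ) hw).differentiableWithinAt) (strip_mem_nhds hz)

lemma abs_im_sub_le (z : ℂ) (a : ℝ) : |(z - I * a).im| ≤ |z.im| + |a| := by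
  simpa using abs_sub z.im a

lemma abs_im_add_le (z : ℂ) (a : ℝ) : |(z + I * a).im| ≤ |z.im| + |a| := by
  simpa using abs_add_le z.im a

lemma exp_sub_exp_linePt (x a : ℝ) (z : ℂ) :
    exp (-I * linePt ε x * (z - I * a)) - exp (-I * linePt ε x * (z + I * a)) =
      -2 * sinh (a * linePt ε x) * exp (-I * linePt ε x * z) := by
  rw [show -I * linePt ε x * (z - I * a) = -(a * linePt ε x) + -I * linePt ε x * z by
      linear_combination (a * linePt ε x) * I_sq,
    show -I * linePt ε x * (z + I * a) = (a * linePt ε x) + -I * linePt ε x * z by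
      linear_combination -(a * linePt ε x) * I_sq, exp_add, exp_add]
  rw [Complex.sinh]
  ring

/-- The difference multiplies the integrand by `-2 sinh(πτu)`, cancelling that factor of the kernel
and leaving `1 / (u sinh(πu))`. -/
lemma faddeevLog_sub_tau (hτ : 0 < τ) (hε : 0 < ε) (hε1 : ε < 1) (hετ : ε * τ < 1) {z : ℂ}
    (hz : |z.im| < Real.pi) :
    faddeevLog τ ε (z - I * (Real.pi * τ : ℝ)) - faddeevLog τ ε (z + I * (Real.pi * τ : ℝ)) =
      log (1 + exp z) := by
  have hpτ := mul_pos Real.pi_pos hτ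
  have hpτε : Real.pi * τ * ε < Real.pi := by nlinarith [Real.pi_pos]
  have b : |z.im| + |Real.pi * τ| < Real.pi * (1 + τ) := by rw [abs_of_pos hpτ]; linarith
  have h1 := integrable_faddeevKernel hτ hε hε1 hετ ((abs_im_sub_le z _).trans_lt b)
  have h2 := integrable_faddeevKernel hτ hε hε1 hετ ((abs_im_add_le z _).trans_lt b)
  have key := lineIntegral_inv_mul_inv_sinh hε hε1 hz
  calc _ = I / 2 * lineIntegral ε (fun x => (sinh (Real.pi * linePt ε x))⁻¹ * (I / linePt ε x)) z := by
        simp only [faddeevLog, lineIntegral]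
        rw [← integral_sub h1 h2, ← integral_const_mul]
        congr 1 with x
        have hs := sinh_linePt_ne_zero hpτ hε hpτε x
        rw [← sub_mul, exp_sub_exp_linePt]
        push_cast at hs ⊢
        rw [faddeevKernel, mul_inv, mul_inv, mul_inv]
        field_simp
        rw [I_sq]
        ring
    _ = _ := by
        rw [key]
        linear_combination -log (1 + exp z) * I_sq

/-- Here `sinh(πu)` cancels. Substituting `τu` for `u` reduces the rest to the same integral at
height `ετ` and argument `z/τ`. -/
lemma faddeevLog_sub_one (hτ : 0 < τ) (hε : 0 < ε) (hε1 : ε < 1) (hετ : ε * τ < 1) {z : ℂ}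
    (hz : |z.im| < Real.pi * τ) :
    faddeevLog τ ε (z - I * Real.pi) - faddeevLog τ ε (z + I * Real.pi) =
      log (1 + exp (z / τ)) := by
  have hτ0 : (τ : ℂ) ≠ 0 := by exact_mod_cast hτ.ne'
  have hpε : Real.pi * ε < Real.pi := by nlinarith [Real.pi_pos]
  have b : |z.im| + |Real.pi| < Real.pi * (1 + τ) := by rw [abs_of_pos Real.pi_pos]; linarith
  have h1 := integrable_faddeevKernel hτ hε hε1 hετ ((abs_im_sub_le z _).trans_lt b)
  have h2 := integrable_faddeevKernel hτ hε hε1 hετ ((abs_im_add_le z _).trans_lt b)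
  have hz' : |(z / τ).im| < Real.pi := by
    rwa [div_ofReal_im, abs_div, abs_of_pos hτ, div_lt_iff₀ hτ]
  have key := lineIntegral_inv_mul_inv_sinh (mul_pos hε hτ) hετ hz'
  have hl : ∀ x : ℝ, linePt (ε * τ) (τ * x) = τ * linePt ε x := fun x => by
    simp only [linePt]; push_cast; ring
  calc _ = ∫ x : ℝ, (I / 2 * τ) * (exp (-I * linePt (ε * τ) (τ * x) * (z / τ)) *
          ((sinh (Real.pi * linePt (ε * τ) (τ * x)))⁻¹ * (I / linePt (ε * τ) (τ * x)))) := by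
        simp only [faddeevLog, lineIntegral]
        rw [← integral_sub h1 h2]
        congr 1 with x
        have hs := sinh_linePt_ne_zero Real.pi_pos hε hpε x
        have h0 := linePt_ne_zero hε x
        rw [← sub_mul, exp_sub_exp_linePt, hl, show -I * (τ * linePt ε x) * (z / τ) =
          -I * linePt ε x * z by field_simp, ← mul_assoc (Real.pi : ℂ)]
        rw [faddeevKernel, mul_inv, mul_inv, mul_inv]
        field_simp
        rw [I_sq]
        ring
    _ = I / 2 * lineIntegral (ε * τ) (fun x => (sinh (Real.pi * linePt (ε * τ) x))⁻¹ *
          (I / linePt (ε * τ) x)) (z / τ) := by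
        rw [integral_const_mul, lineIntegral, Measure.integral_comp_mul_left
          (fun x : ℝ => exp (-I * linePt (ε * τ) x * (z / τ)) *
          ((sinh (Real.pi * linePt (ε * τ) x))⁻¹ * (I / linePt (ε * τ) x)))]
        rw [abs_of_pos (inv_pos.2 hτ), Complex.real_smul, ← mul_assoc, mul_assoc (I / 2),
          ofReal_inv, mul_inv_cancel₀ hτ0, mul_one]
    _ = _ := by
        rw [key]
        linear_combination -log (1 + exp (z / τ)) * I_sq

lemma exp_faddeevLog_sub_tau (hτ : 0 < τ) (hε : 0 < ε) (hε1 : ε < 1) (hετ : ε * τ < 1) {z : ℂ}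
    (hz : |z.im| < Real.pi) :
    exp (faddeevLog τ ε (z - I * (Real.pi * τ : ℝ))) =
      (1 + exp z) * exp (faddeevLog τ ε (z + I * (Real.pi * τ : ℝ))) := by
  rw [sub_eq_iff_eq_add.1 (faddeevLog_sub_tau hτ hε hε1 hετ hz), exp_add,
    exp_log (one_add_exp_ne_zero hz)]

lemma abs_im_div_lt (hτ : 0 < τ) {z : ℂ} (hz : |z.im| < Real.pi * τ) :
    |(z / τ).im| < Real.pi := by
  rwa [div_ofReal_im, abs_div, abs_of_pos hτ, div_lt_iff₀ hτ]

lemma exp_faddeevLog_sub_one (hτ : 0 < τ) (hε : 0 < ε) (hε1 : ε < 1) (hετ : ε * τ < 1) {z : ℂ}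
    (hz : |z.im| < Real.pi * τ) :
    exp (faddeevLog τ ε (z - I * Real.pi)) =
      (1 + exp (z / τ)) * exp (faddeevLog τ ε (z + I * Real.pi)) := by
  rw [sub_eq_iff_eq_add.1 (faddeevLog_sub_one hτ hε hε1 hετ hz), exp_add,
    exp_log (one_add_exp_ne_zero (abs_im_div_lt hτ hz))]

/-- The substitution `x = π b u`, `b = √τ`, in Faddeev's integrand. -/
lemma faddeevIntegrand_eq (hτ : 0 < τ) (z : ℂ) (x : ℝ) :
    faddeevIntegrand √τ (z / (2 * Real.pi * √τ)) (x + I * ε) =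
      ((Real.pi * √τ)⁻¹ : ℝ) * (exp (-I * linePt (ε / (Real.pi * √τ)) (x / (Real.pi * √τ)) * z) *
        faddeevKernel τ (ε / (Real.pi * √τ)) (x / (Real.pi * √τ))) := by
  have hb := Real.sqrt_pos.2 hτ
  have hb0 : ((√τ : ℝ) : ℂ) ≠ 0 := by exact_mod_cast hb.ne'
  have hπ : (Real.pi : ℂ) ≠ 0 := by exact_mod_cast Real.pi_pos.ne'
  have hbb : (τ : ℂ) = (√τ : ℝ) * (√τ : ℝ) := by
    rw [← ofReal_mul, Real.mul_self_sqrt hτ.le]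
  have hX : (x + I * ε : ℂ) = Real.pi * (√τ : ℝ) *
      linePt (ε / (Real.pi * √τ)) (x / (Real.pi * √τ)) := by
    simp only [linePt]; push_cast; field_simp
  rw [faddeevIntegrand, hX, faddeevKernel]
  generalize linePt (ε / (Real.pi * √τ)) (x / (Real.pi * √τ)) = u
  rw [show -2 * I * (Real.pi * (√τ : ℝ) * u) * (z / (2 * Real.pi * (√τ : ℝ))) = -I * u * z by
      field_simp,
    show (Real.pi : ℂ) * τ * u = Real.pi * (√τ : ℝ) * u * (√τ : ℝ) by rw [hbb]; ring,
    show Real.pi * (√τ : ℝ) * u / (√τ : ℝ) = Real.pi * u by field_simp]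
  push_cast
  rw [div_eq_mul_inv]
  simp only [mul_inv]
  ring

/-- Under the scaling by `πb` the two bounds say that the line runs below the first poles `i` and
`i/τ` of the kernel. -/
lemma scaled_eps_bounds (hτ : 0 < τ) (hε : 0 < ε) (h1 : ε < Real.pi * √τ)
    (h2 : ε < Real.pi / √τ) :
    0 < ε / (Real.pi * √τ) ∧ ε / (Real.pi * √τ) < 1 ∧ ε / (Real.pi * √τ) * τ < 1 := by
  have hb := Real.sqrt_pos.2 hτ
  have hπ := Real.pi_pos
  refine ⟨by positivity, by rwa [div_lt_one (by positivity)], ?_⟩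
  rw [lt_div_iff₀ hb] at h2
  rw [div_mul_eq_mul_div, div_lt_one (by positivity)]
  nlinarith [Real.mul_self_sqrt hτ.le]

lemma integrable_faddeevIntegrand (hτ : 0 < τ) (hε : 0 < ε) (h1 : ε < Real.pi * √τ)
    (h2 : ε < Real.pi / √τ) {z : ℂ} (hz : |z.im| < Real.pi * (1 + τ)) :
    Integrable fun x : ℝ => faddeevIntegrand √τ (z / (2 * Real.pi * √τ)) (x + I * ε) := by
  obtain ⟨e0, e1, e2⟩ := scaled_eps_bounds hτ hε h1 h2
  have hb := Real.sqrt_pos.2 hτ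
  simp only [faddeevIntegrand_eq hτ]
  exact ((integrable_faddeevKernel hτ e0 e1 e2 hz).comp_div
    (mul_pos Real.pi_pos hb).ne').const_mul _

lemma faddeev_eq (hτ : 0 < τ) (z : ℂ) :
    faddeev ε √τ (z / (2 * Real.pi * √τ)) = exp (faddeevLog τ (ε / (Real.pi * √τ)) z) := by
  have hb := mul_pos Real.pi_pos (Real.sqrt_pos.2 hτ)
  rw [faddeev]
  simp only [faddeevIntegrand_eq hτ]
  rw [integral_const_mul, Measure.integral_comp_div (fun x : ℝ =>
    exp (-I * linePt (ε / (Real.pi * √τ)) x * z) * faddeevKernel τ (ε / (Real.pi * √τ)) x),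
    abs_of_pos hb, Complex.real_smul, ← mul_assoc, ← ofReal_mul, inv_mul_cancel₀ hb.ne', ofReal_one,
    one_mul]
  rfl

end

/-! ### Identity theorems -/

/-- Identity theorem for meromorphic functions. -/
lemma eventuallyEq_nhdsNE_of_isPreconnected {f g : ℂ → ℂ} {U : Set ℂ} (hf : MeromorphicOn f U)
    (hg : MeromorphicOn g U) (hU : IsPreconnected U) {z₀ z : ℂ} (hz₀ : z₀ ∈ U) (hz : z ∈ U)
    (h : f =ᶠ[𝓝[≠] z₀] g) : f =ᶠ[𝓝[≠] z] g := by
  have h0 : meromorphicOrderAt (f - g) z₀ = ⊤ := by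
    rw [meromorphicOrderAt_eq_top_iff]
    filter_upwards [h] with w hw
    simp [hw]
  have h1 : meromorphicOrderAt (f - g) z = ⊤ := by
    by_contra hne
    exact (hf.sub hg).meromorphicOrderAt_ne_top_of_isPreconnected hU hz hz₀ hne h0
  rw [meromorphicOrderAt_eq_top_iff] at h1
  filter_upwards [h1] with w hw
  exact sub_eq_zero.1 hw

/-- Normal form fixes the values at poles and removable singularities, so agreement off a discrete
set becomes equality everywhere. -/
lemma eqOn_of_meromorphicNFOn {f g : ℂ → ℂ} {U : Set ℂ} (hf : MeromorphicNFOn f U)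
    (hg : MeromorphicNFOn g U) (hU : IsPreconnected U) {z₀ : ℂ} (hz₀ : z₀ ∈ U)
    (h : f =ᶠ[𝓝[≠] z₀] g) : Set.EqOn f g U := fun _ hz =>
  (((hf hz).eventuallyEq_nhdsNE_iff_eventuallyEq_nhds (hg hz)).1
    (eventuallyEq_nhdsNE_of_isPreconnected hf.meromorphicOn hg.meromorphicOn hU hz₀ hz h)).eq_of_nhds

lemma eq_of_analyticAt_of_meromorphicOn {f g : ℂ → ℂ} (hf : MeromorphicOn f Set.univ)
    (hg : MeromorphicOn g Set.univ) (h : f =ᶠ[𝓝 0] g) {z : ℂ} (hfz : AnalyticAt ℂ f z)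
    (hgz : AnalyticAt ℂ g z) : f z = g z :=
  ((hfz.continuousAt.eventuallyEq_nhds_iff_eventuallyEq_nhdsNE hgz.continuousAt).1
    (eventuallyEq_nhdsNE_of_isPreconnected hf hg isPreconnected_univ (Set.mem_univ 0)
      (Set.mem_univ z) (h.filter_mono nhdsWithin_le_nhds))).eq_of_nhds

/-! ### Meromorphic continuation strip by strip -/

section Continuation

variable {τ : ℝ} {E : ℂ → ℂ}

/-- The factor by which the continuation at `z` differs from `E (z - 2πik)`. -/
def shiftFactor (τ : ℝ) (k : ℤ) (z : ℂ) : ℂ :=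
  (∏ j ∈ Finset.range k.toNat, (1 + exp ((z - I * (Real.pi * (2 * j + 1))) / τ)))⁻¹ *
    ∏ j ∈ Finset.range (-k).toNat, (1 + exp ((z + I * (Real.pi * (2 * j + 1))) / τ))

lemma meromorphicAt_shiftFactor (τ : ℝ) (k : ℤ) (z : ℂ) : MeromorphicAt (shiftFactor τ k) z := by
  apply MeromorphicAt.fun_mul
  · apply MeromorphicAt.fun_inv
    exact (Finset.analyticAt_fun_prod _ fun j _ => by fun_prop).meromorphicAt
  · exact (Finset.analyticAt_fun_prod _ fun j _ => by fun_prop).meromorphicAt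

lemma shiftFactor_succ (τ : ℝ) (k : ℤ) {z : ℂ}
    (h : 1 + exp ((z - I * (Real.pi * (2 * k + 1))) / τ) ≠ 0) :
    shiftFactor τ (k + 1) z =
      shiftFactor τ k z * (1 + exp ((z - I * (Real.pi * (2 * k + 1))) / τ))⁻¹ := by
  rcases le_or_gt 0 k with hk | hk
  · obtain ⟨n, rfl⟩ := Int.eq_ofNat_of_zero_le hk
    have e1 : ((n : ℤ) + 1).toNat = n + 1 := by omega
    have e2 : (-((n : ℤ) + 1)).toNat = 0 := by omega
    have e3 : (-(n : ℤ)).toNat = 0 := by omega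
    simp only [shiftFactor, e1, e2, e3, Int.toNat_natCast, Finset.prod_range_succ,
      Finset.range_zero, Finset.prod_empty, mul_one, mul_inv, Int.cast_natCast]
  -- For negative `k` the step to `k + 1` drops the last factor of the second product, hence the
  -- need for that factor to be nonzero.
  · obtain ⟨n, rfl⟩ : ∃ n : ℕ, k = -((n : ℤ) + 1) := ⟨(-k - 1).toNat, by omega⟩
    have e1 : (-((n : ℤ) + 1)).toNat = 0 := by omega
    have e2 : (- -((n : ℤ) + 1)).toNat = n + 1 := by omega
    have e3 : (-((n : ℤ) + 1) + 1).toNat = 0 := by omega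
    have e4 : (-(-((n : ℤ) + 1) + 1)).toNat = n := by omega
    have e5 : z - I * (Real.pi * (2 * ((-((n : ℤ) + 1) : ℤ) : ℂ) + 1)) =
        z + I * (Real.pi * (2 * n + 1)) := by
      push_cast; ring
    rw [e5] at h ⊢
    simp only [shiftFactor, e1, e2, e3, e4, Finset.prod_range_succ,
      Finset.range_zero, Finset.prod_empty, inv_one, one_mul]
    rw [mul_assoc, mul_inv_cancel₀ h, mul_one]

/-- The continuation of `E` to the strip `|Im z - 2πk| < π(1 + τ)`. -/
def shifted (τ : ℝ) (E : ℂ → ℂ) (k : ℤ) (z : ℂ) : ℂ :=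
  E (z - I * (2 * Real.pi * k)) * shiftFactor τ k z

/-- Consecutive strips overlap in `|Im z - π(2k + 1)| < πτ`; recentred at `w`, this is the domain of
the second functional equation. -/
lemma shifted_succ (hτ : 0 < τ)
    (hE : ∀ z : ℂ, |z.im| < Real.pi * τ →
      E (z - I * Real.pi) = (1 + exp (z / τ)) * E (z + I * Real.pi)) (k : ℤ) {z : ℂ}
    (h1 : |z.im - 2 * Real.pi * k| < Real.pi * (1 + τ))
    (h2 : |z.im - 2 * Real.pi * (k + 1 : ℤ)| < Real.pi * (1 + τ)) :
    shifted τ E (k + 1) z = shifted τ E k z := by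
  set w : ℂ := z - I * (Real.pi * (2 * k + 1)) with hw
  have him : w.im = z.im - Real.pi * (2 * k + 1) := by simp [hw]
  have hwτ : |w.im| < Real.pi * τ := by
    push_cast at h2
    rw [abs_lt] at h1 h2 ⊢
    rw [him]
    constructor <;> nlinarith
  have hne := one_add_exp_ne_zero (abs_im_div_lt hτ hwτ)
  have e1 : z - I * (2 * Real.pi * (k + 1 : ℤ)) = w - I * Real.pi := by
    rw [hw]; push_cast; ring
  have e2 : z - I * (2 * Real.pi * k) = w + I * Real.pi := by
    rw [hw]; ring
  rw [shifted, shifted, shiftFactor_succ τ k hne, ← hw, e1, e2, hE w hwτ]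
  field_simp

/-- The global meromorphic continuation of `E`. -/
def continuation (τ : ℝ) (E : ℂ → ℂ) (z : ℂ) : ℂ :=
  shifted τ E (round (z.im / (2 * Real.pi))) z

/-- The bound `2π` makes `k` the nearest index or one of its neighbours, so a single comparison of
consecutive strips suffices even when `τ` is large and many strips overlap. -/
lemma continuation_eq_shifted (hτ : 0 < τ)
    (hE : ∀ z : ℂ, |z.im| < Real.pi * τ →
      E (z - I * Real.pi) = (1 + exp (z / τ)) * E (z + I * Real.pi)) (k : ℤ) {z : ℂ}
    (h : |z.im - 2 * Real.pi * k| < Real.pi * (1 + τ))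
    (h' : |z.im - 2 * Real.pi * k| < 2 * Real.pi) :
    continuation τ E z = shifted τ E k z := by
  have hπ := Real.pi_pos
  set r := round (z.im / (2 * Real.pi)) with hr
  have hr1 : |z.im - 2 * Real.pi * r| ≤ Real.pi := by
    have := abs_sub_round (z.im / (2 * Real.pi))
    rw [← hr] at this
    have e : z.im - 2 * Real.pi * r = 2 * Real.pi * (z.im / (2 * Real.pi) - r) := by field_simp
    rw [e, abs_mul, abs_of_pos (by positivity)]
    nlinarith
  have hr2 : |z.im - 2 * Real.pi * r| < Real.pi * (1 + τ) := by nlinarith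
  have hd : |(r : ℝ) - k| < 3 / 2 := by
    rw [abs_lt] at h' ⊢
    rw [abs_le] at hr1
    constructor <;> nlinarith
  have hd' : r = k ∨ r = k + 1 ∨ r + 1 = k := by
    rw [abs_lt] at hd
    have a : r - k < 2 := by
      have : ((r - k : ℤ) : ℝ) < (2 : ℤ) := by push_cast; linarith
      exact_mod_cast this
    have b : -2 < r - k := by
      have : ((-2 : ℤ) : ℝ) < ((r - k : ℤ) : ℝ) := by push_cast; linarith
      exact_mod_cast this
    omega
  rw [continuation, ← hr]
  rcases hd' with e | e | e
  · rw [e]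
  · rw [e] at hr2 ⊢
    exact shifted_succ hτ hE k h hr2
  · rw [← e] at h ⊢
    exact (shifted_succ hτ hE r hr2 h).symm

lemma continuation_eventuallyEq (hτ : 0 < τ)
    (hE : ∀ z : ℂ, |z.im| < Real.pi * τ →
      E (z - I * Real.pi) = (1 + exp (z / τ)) * E (z + I * Real.pi)) (k : ℤ) {z : ℂ}
    (h : |z.im - 2 * Real.pi * k| ≤ Real.pi) :
    continuation τ E =ᶠ[𝓝 z] shifted τ E k := by
  have hπ := Real.pi_pos
  have hc : Continuous fun w : ℂ => |w.im - 2 * Real.pi * k| := by fun_prop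
  have o1 := (isOpen_lt hc continuous_const).mem_nhds
    (show |z.im - 2 * Real.pi * k| < Real.pi * (1 + τ) by nlinarith)
  have o2 := (isOpen_lt hc continuous_const).mem_nhds
    (show |z.im - 2 * Real.pi * k| < 2 * Real.pi by linarith)
  filter_upwards [o1, o2] with w h1 h2
  exact continuation_eq_shifted hτ hE k h1 h2

lemma meromorphicOn_continuation (hτ : 0 < τ)
    (hE : ∀ z : ℂ, |z.im| < Real.pi * τ →
      E (z - I * Real.pi) = (1 + exp (z / τ)) * E (z + I * Real.pi))
    (hEa : ∀ z : ℂ, |z.im| < Real.pi * (1 + τ) → AnalyticAt ℂ E z) :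
    MeromorphicOn (continuation τ E) Set.univ := by
  intro z _
  have hπ := Real.pi_pos
  set r := round (z.im / (2 * Real.pi)) with hr
  have hr1 : |z.im - 2 * Real.pi * r| ≤ Real.pi := by
    have := abs_sub_round (z.im / (2 * Real.pi))
    rw [← hr] at this
    have e : z.im - 2 * Real.pi * r = 2 * Real.pi * (z.im / (2 * Real.pi) - r) := by field_simp
    rw [e, abs_mul, abs_of_pos (by positivity)]
    nlinarith
  refine MeromorphicAt.congr ?_ ((continuation_eventuallyEq hτ hE r hr1).symm.filter_mono
    nhdsWithin_le_nhds)
  refine MeromorphicAt.fun_mul (AnalyticAt.meromorphicAt ?_) (meromorphicAt_shiftFactor τ r z)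
  have : AnalyticAt ℂ E (z - I * (2 * Real.pi * r)) := by
    apply hEa
    have : (z - I * (2 * Real.pi * r)).im = z.im - 2 * Real.pi * r := by simp
    rw [this]
    nlinarith
  exact AnalyticAt.fun_comp this (by fun_prop)

lemma continuation_eventuallyEq_zero (hτ : 0 < τ)
    (hE : ∀ z : ℂ, |z.im| < Real.pi * τ →
      E (z - I * Real.pi) = (1 + exp (z / τ)) * E (z + I * Real.pi)) :
    continuation τ E =ᶠ[𝓝 0] E := by
  refine (continuation_eventuallyEq hτ hE 0 (by simpa using Real.pi_pos.le)).trans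
    (.of_eq ?_)
  funext z
  simp [shifted, shiftFactor]

end Continuation

/-! ### Existence, uniqueness and functional equations of the Borel solution -/

section Solution

variable {τ ε : ℝ} {f : ℂ → ℂ}

lemma exp_faddeevLog_eq (hτ : 0 < τ) (hε : 0 < ε) (hε1 : ε < 1) (hετ : ε * τ < 1) {z : ℂ}
    (hz : |z.im| < Real.pi) :
    exp (faddeevLog τ ε z) = exp (dilog (-exp z) / (2 * Real.pi * I * τ) + borelSum τ z) := by
  rw [faddeevLog_eq hτ hε hε1 hετ hz]
  rfl

/-- By uniqueness of Borel sums the two functions agree on `|Im z| < π`; the identity theorem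
carries this to the wider strip, for every admissible height of the line. -/
lemma IsBorelSolution.eq_exp_faddeevLog (hf : IsBorelSolution τ f) (hτ : 0 < τ) (hε : 0 < ε)
    (hε1 : ε < 1) (hετ : ε * τ < 1) :
    Set.EqOn f (fun z => exp (faddeevLog τ ε z)) {z : ℂ | |z.im| < Real.pi * (1 + τ)} := by
  have hπ := Real.pi_pos
  have h0 : f =ᶠ[𝓝 0] fun z => exp (faddeevLog τ ε z) := by
    filter_upwards [strip_mem_nhds (z := 0) (a := Real.pi) (by simpa using hπ)] with z hz
    obtain ⟨s, hs, h⟩ := hf.2 z hz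
    rw [h, exp_faddeevLog_eq hτ hε hε1 hετ hz, hs.unique (isBorelSum_borelSum hτ hz)]
  have ha : AnalyticOnNhd ℂ (fun z => exp (faddeevLog τ ε z))
      {z : ℂ | |z.im| < Real.pi * (1 + τ)} :=
    fun z hz => (analyticAt_faddeevLog hτ hε hε1 hετ hz).cexp'
  exact eqOn_of_meromorphicNFOn (fun z _ => hf.1 (Set.mem_univ z)) ha.meromorphicNFOn
    (convex_strip _).isPreconnected (z₀ := 0) (by simp; positivity)
    (h0.filter_mono nhdsWithin_le_nhds)

lemma exists_isBorelSolution (hτ : 0 < τ) (hε : 0 < ε) (hε1 : ε < 1) (hετ : ε * τ < 1) :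
    ∃ f, IsBorelSolution τ f := by
  have hπ := Real.pi_pos
  set E : ℂ → ℂ := fun z => exp (faddeevLog τ ε z)
  have hE := fun (z : ℂ) hz => exp_faddeevLog_sub_one hτ hε hε1 hετ (z := z) hz
  have hEa : ∀ z : ℂ, |z.im| < Real.pi * (1 + τ) → AnalyticAt ℂ E z :=
    fun z hz => (analyticAt_faddeevLog hτ hε hε1 hετ hz).cexp'
  have hm := meromorphicOn_continuation (E := E) hτ hE hEa
  set f := toMeromorphicNFOn (continuation τ E) Set.univ
  have hf : MeromorphicNFOn f Set.univ := meromorphicNFOn_toMeromorphicNFOn _ _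
  have h0 : f =ᶠ[𝓝[≠] 0] E := (hm.toMeromorphicNFOn_eq_self_on_nhdsNE (Set.mem_univ 0)).trans
    ((continuation_eventuallyEq_zero hτ hE).filter_mono nhdsWithin_le_nhds)
  have ha : AnalyticOnNhd ℂ E {z : ℂ | |z.im| < Real.pi} := fun z hz => hEa z (by
    have : |z.im| < Real.pi := hz
    nlinarith)
  have heq := eqOn_of_meromorphicNFOn (fun z _ => hf (Set.mem_univ z)) ha.meromorphicNFOn
    (convex_strip _).isPreconnected (z₀ := 0) (by simpa using hπ) h0
  refine ⟨f, hf, fun z hz => ⟨borelSum τ z, isBorelSum_borelSum hτ hz, ?_⟩⟩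
  rw [heq hz]
  exact exp_faddeevLog_eq hτ hε hε1 hετ hz

lemma IsBorelSolution.unique {g : ℂ → ℂ} (hf : IsBorelSolution τ f) (hg : IsBorelSolution τ g) :
    f = g := by
  have hπ := Real.pi_pos
  refine Set.eqOn_univ _ _ |>.1 (eqOn_of_meromorphicNFOn hf.1 hg.1 isPreconnected_univ
    (Set.mem_univ 0) (EventuallyEq.filter_mono ?_ nhdsWithin_le_nhds))
  filter_upwards [strip_mem_nhds (z := 0) (a := Real.pi) (by simpa using hπ)] with z hz
  obtain ⟨s, hs, h⟩ := hf.2 z hz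
  obtain ⟨t, ht, h'⟩ := hg.2 z hz
  rw [h, h', hs.unique ht]

/-- A functional equation between shifts of a meromorphic function propagates from a neighbourhood
of `0`. -/
lemma shift_equation_of_eventually (hf : MeromorphicNFOn f Set.univ) {c : ℂ} {g : ℂ → ℂ}
    (hg : ∀ z, AnalyticAt ℂ g z) (h : ∀ᶠ z in 𝓝 0, f (z - c) = g z * f (z + c)) {z : ℂ}
    (h1 : AnalyticAt ℂ f (z - c)) (h2 : AnalyticAt ℂ f (z + c)) :
    f (z - c) = g z * f (z + c) := by
  have m1 : MeromorphicOn (fun z => f (z - c)) Set.univ := fun w _ =>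
    (hf.meromorphicOn (w - c) (Set.mem_univ _)).comp_analyticAt (g := fun z => z - c) (by fun_prop)
  have m2 : MeromorphicOn (fun z => g z * f (z + c)) Set.univ := fun w _ =>
    (hg w).meromorphicAt.fun_mul
      ((hf.meromorphicOn (w + c) (Set.mem_univ _)).comp_analyticAt (g := fun z => z + c)
        (by fun_prop))
  exact eq_of_analyticAt_of_meromorphicOn m1 m2 h
    (AnalyticAt.fun_comp (f := fun z => z - c) h1 (by fun_prop))
    ((hg z).fun_mul (AnalyticAt.fun_comp (f := fun z => z + c) h2 (by fun_prop)))

lemma exists_contour_height (hτ : 0 < τ) : ∃ ε : ℝ, 0 < ε ∧ ε < 1 ∧ ε * τ < 1 := by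
  refine ⟨1 / (2 + τ), by positivity, ?_, ?_⟩
  · rw [div_lt_one (by positivity)]; linarith
  · rw [div_mul_eq_mul_div, div_lt_one (by positivity)]; linarith

lemma IsBorelSolution.sub_tau (hf : IsBorelSolution τ f) (hτ : 0 < τ) {z : ℂ}
    (h1 : AnalyticAt ℂ f (z - I * Real.pi * τ)) (h2 : AnalyticAt ℂ f (z + I * Real.pi * τ)) :
    f (z - I * Real.pi * τ) = (1 + exp z) * f (z + I * Real.pi * τ) := by
  obtain ⟨ε, hε, hε1, hετ⟩ := exists_contour_height hτ
  have hπ := Real.pi_pos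
  have hS := hf.eq_exp_faddeevLog hτ hε hε1 hετ
  refine shift_equation_of_eventually hf.1 (g := fun z => 1 + exp z) (fun w => by fun_prop) ?_ h1 h2
  filter_upwards [strip_mem_nhds (z := 0) (a := Real.pi) (by simpa using hπ)] with w hw
  have e : I * Real.pi * τ = I * (Real.pi * τ : ℝ) := by push_cast; ring
  have b : |w.im| + |Real.pi * τ| < Real.pi * (1 + τ) := by
    rw [abs_of_pos (mul_pos hπ hτ)]
    have : |w.im| < Real.pi := hw
    linarith
  rw [e, hS ((abs_im_sub_le w _).trans_lt b), hS ((abs_im_add_le w _).trans_lt b)]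
  exact exp_faddeevLog_sub_tau hτ hε hε1 hετ hw

lemma IsBorelSolution.sub_one (hf : IsBorelSolution τ f) (hτ : 0 < τ) {z : ℂ}
    (h1 : AnalyticAt ℂ f (z - I * Real.pi)) (h2 : AnalyticAt ℂ f (z + I * Real.pi)) :
    f (z - I * Real.pi) = (1 + exp (z / τ)) * f (z + I * Real.pi) := by
  obtain ⟨ε, hε, hε1, hετ⟩ := exists_contour_height hτ
  have hπ := Real.pi_pos
  have hS := hf.eq_exp_faddeevLog hτ hε hε1 hετ
  refine shift_equation_of_eventually hf.1 (g := fun z => 1 + exp (z / τ))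
    (fun w => by fun_prop) ?_ h1 h2
  filter_upwards [strip_mem_nhds (z := 0) (a := Real.pi * τ) (by simp; positivity)] with w hw
  have b : |w.im| + |Real.pi| < Real.pi * (1 + τ) := by
    rw [abs_of_pos hπ]
    have : |w.im| < Real.pi * τ := hw
    linarith
  rw [hS ((abs_im_sub_le w _).trans_lt b), hS ((abs_im_add_le w _).trans_lt b)]
  exact exp_faddeevLog_sub_one hτ hε hε1 hετ hw

end Solution

end BorelDilog

end

theorem corollary1p6 (τ : ℝ) (hτ : 0 < τ) :
    -- `f_τ` exists and is unique
    (∃! f : ℂ → ℂ, BorelDilog.IsBorelSolution τ f) ∧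
    ∀ f : ℂ → ℂ, BorelDilog.IsBorelSolution τ f →
      -- the first functional equation, wherever neither side sits at a pole of `f`
      (∀ z : ℂ, AnalyticAt ℂ f (z - I * Real.pi * τ) → AnalyticAt ℂ f (z + I * Real.pi * τ) →
        f (z - I * Real.pi * τ) = (1 + Complex.exp z) * f (z + I * Real.pi * τ)) ∧
      -- the second functional equation, wherever neither side sits at a pole of `f`
      (∀ z : ℂ, AnalyticAt ℂ f (z - I * Real.pi) → AnalyticAt ℂ f (z + I * Real.pi) →
        f (z - I * Real.pi) = (1 + Complex.exp (z / τ)) * f (z + I * Real.pi)) ∧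
      -- `f_τ(z) = Φ_b(z / (2πb))` with `b = √τ`, where Faddeev's integral converges
      (∀ ε : ℝ, 0 < ε → ε < Real.pi * √τ → ε < Real.pi / √τ →
        ∀ z : ℂ, |z.im| < Real.pi * (1 + τ) →
          Integrable (fun x : ℝ =>
            BorelDilog.faddeevIntegrand √τ (z / (2 * Real.pi * √τ)) (x + I * ε)) ∧
          f z = BorelDilog.faddeev ε √τ (z / (2 * Real.pi * √τ))) := by
  obtain ⟨ε₀, hε₀, hε₀1, hε₀τ⟩ := BorelDilog.exists_contour_height hτ
  obtain ⟨f₀, hf₀⟩ := BorelDilog.exists_isBorelSolution hτ hε₀ hε₀1 hε₀τ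
  refine ⟨⟨f₀, hf₀, fun g hg => hg.unique hf₀⟩, fun f hf => ⟨fun z h1 h2 => hf.sub_tau hτ h1 h2,
    fun z h1 h2 => hf.sub_one hτ h1 h2, fun ε hε h1 h2 z hz =>
      ⟨BorelDilog.integrable_faddeevIntegrand hτ hε h1 h2 hz, ?_⟩⟩⟩
  obtain ⟨e0, e1, e2⟩ := BorelDilog.scaled_eps_bounds hτ hε h1 h2
  rw [BorelDilog.faddeev_eq hτ]
  exact hf.eq_exp_faddeevLog hτ e0 e1 e2 hz
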